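/- A permutation of length $n$ is a sequence $\pi=\pi_1,\dots,\pi_n$ containing each element of $\{1,\dots,n\}$ exactly once; its diagram is the point set $S_\pi=\{(i,\pi_i) : 1\le i\le n\}$. Two finite planar point sets, each with pairwise distinct $x$-coordinates and pairwise distinct $y$-coordinates, are isomorphic if there is a bijection between them preserving and reflecting the order of the $x$-coordinates and the order of the $y$-coordinates. A permutation $\tau$ contains $\pi$ if $S_\tau$ has a subset isomorphic to $S_\pi$; otherwise $\tau$ avoids $\pi$, and $\mathrm{Av}(\alpha)$ denotes the class of all permutations avoiding $\alpha$. The inflation $\sigma[\tau_1,\dots,\tau_n]$ of a permutation $\sigma$ of length $n$ by nonempty permutations $\tau_1,\dots,\tau_n$ is the permutation whose diagram is isomorphic to the point set obtained from $S_\sigma$ by replacing each point $(i,\sigma_i)$ with a tiny copy of $S_{\tau_i}$. A permutation $\pi$ is simple if it is not of the form $\sigma[\tau_1,\dots,\tau_n]$ with $\sigma,\tau_1,\dots,\tau_n$ all strictly shorter than $\pi$. The merge $\mathcal C\odot\mathcal D$ of two classes is the set of all permutations $\pi$ whose points can be coloured red and blue so that the red points are isomorphic to (the diagram of) a member of $\mathcal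 C$ and the blue points to a member of $\mathcal D$ (one colour may be unused). A permutation $\pi$ is regarded as a structure with domain $S_\pi$ over the signature of two binary relation symbols $<_1,<_2$ (a model of the Theory of Two Orders, TOTO), where $<_1$ and $<_2$ are interpreted as the orders of the points by $x$-coordinate and by $y$-coordinate. A set $\mathcal C$ of permutations is definable by a first-order sentence in TOTO if there is a first-order sentence $\varphi$ over this signature (with equality) such that for every permutation $\pi$, $\pi\models\varphi$ if and only if $\pi\in\mathcal C$. **Theorem.** Let $\alpha$ be a simple permutation of length at least $4$. Then the class $\mathrm{Av}(\alpha)\odot\mathrm{Av}(\alpha)$ is not definable by a first-order sentence in TOTO. -/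

import Mathlib

/-! A permutation of length `n` is an element of `Equiv.Perm (Fin n)`; a set of permutations (of
arbitrary lengths) is a `Set (Σ n : ℕ, Equiv.Perm (Fin n))`. -/

namespace PermLogic

/-- The permutation diagram of `π`: the set of points `(i, π i)`. -/
def diagram {n : ℕ} (π : Equiv.Perm (Fin n)) : Set (Fin n × Fin n) :=
  {p | p.2 = π p.1}

/-- Two planar point sets are isomorphic if some bijection between them preserves and reflects the
strict order of the `x`-coordinates and the strict order of the `y`-coordinates. The coordinates
may be taken in arbitrary linear orders. -/
def Isomorphic {X Y X' Y' : Type*} [LinearOrder X] [LinearOrder Y] [LinearOrder X']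
    [LinearOrder Y'] (S : Set (X × Y)) (T : Set (X' × Y')) : Prop :=
  ∃ f : S ≃ T, ∀ p q : S,
    (p.1.1 < q.1.1 ↔ (f p).1.1 < (f q).1.1) ∧ (p.1.2 < q.1.2 ↔ (f p).1.2 < (f q).1.2)

/-- `τ` contains `π`: the diagram of `τ` has a subset isomorphic to the diagram of `π`. -/
def Contains {n m : ℕ} (τ : Equiv.Perm (Fin n)) (π : Equiv.Perm (Fin m)) : Prop :=
  ∃ S ⊆ diagram τ, Isomorphic S (diagram π)

/-- `Av σ` is the class of all `σ`-avoiding permutations. -/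
def Av {m : ℕ} (σ : Equiv.Perm (Fin m)) : Set (Σ n : ℕ, Equiv.Perm (Fin n)) :=
  {π | ¬ Contains π.2 σ}

/-- The point set obtained from the diagram of `σ` by replacing each point `(i, σ i)` with a tiny
copy of the diagram of `τ i`. Points have lexicographically ordered coordinates: the first
component is the coordinate in the diagram of `σ`, the second one the coordinate inside the tiny
copy. -/
def inflationPoints {n : ℕ} (σ : Equiv.Perm (Fin n)) (m : Fin n → ℕ)
    (τ : (i : Fin n) → Equiv.Perm (Fin (m i))) : Set ((Fin n ×ₗ ℕ) × (Fin n ×ₗ ℕ)) :=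
  {p | ∃ (i : Fin n) (a : Fin (m i)),
    p = (toLex (i, (a : ℕ)), toLex (σ i, (τ i a : ℕ)))}

/-- `π` is (isomorphic to, hence equal to) the inflation `σ[τ₁, …, τₙ]`. -/
def IsInflation {N n : ℕ} (π : Equiv.Perm (Fin N)) (σ : Equiv.Perm (Fin n)) (m : Fin n → ℕ)
    (τ : (i : Fin n) → Equiv.Perm (Fin (m i))) : Prop :=
  Isomorphic (diagram π) (inflationPoints σ m τ)

/-- A permutation is simple if it is not an inflation of a strictly smaller permutation by
(nonempty) strictly smaller permutations. -/
def IsSimple {N : ℕ} (π : Equiv.Perm (Fin N)) : Prop :=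
  ¬ ∃ (n : ℕ) (σ : Equiv.Perm (Fin n)) (m : Fin n → ℕ)
    (τ : (i : Fin n) → Equiv.Perm (Fin (m i))),
    n < N ∧ (∀ i, 0 < m i ∧ m i < N) ∧ IsInflation π σ m τ

/-- `π` is a merge of `σ` and `τ`: its points can be coloured red and blue such that the red points
are isomorphic to `σ` and the blue ones to `τ`. One of the colours may be unused. -/
def IsMerge {n k l : ℕ} (π : Equiv.Perm (Fin n)) (σ : Equiv.Perm (Fin k))
    (τ : Equiv.Perm (Fin l)) : Prop :=
  ∃ red blue : Set (Fin n × Fin n), red ∪ blue = diagram π ∧ Disjoint red blue ∧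
    Isomorphic red (diagram σ) ∧ Isomorphic blue (diagram τ)

/-- The merge `C ⊙ D` of two classes of permutations. -/
def merge (C D : Set (Σ n : ℕ, Equiv.Perm (Fin n))) : Set (Σ n : ℕ, Equiv.Perm (Fin n)) :=
  {π | ∃ σ ∈ C, ∃ τ ∈ D, IsMerge π.2 σ.2 τ.2}

/-- The relation symbols `<₁` and `<₂`, both binary. -/
inductive TwoOrderRel : ℕ → Type
  | lt₁ : TwoOrderRel 2
  | lt₂ : TwoOrderRel 2

/-- The signature of two orders: exactly the two binary relation symbols `<₁`, `<₂`. -/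
def twoOrders : FirstOrder.Language := ⟨fun _ => Empty, TwoOrderRel⟩

/-- A permutation as a structure of the signature of two orders: the domain is its diagram, and
`<₁`, `<₂` are the orders of the `x`- and of the `y`-coordinates. -/
@[reducible] def permStructure {n : ℕ} (π : Equiv.Perm (Fin n)) :
    twoOrders.Structure (diagram π) where
  funMap := fun f => nomatch f
  RelMap := fun r => match r with
    | .lt₁ => fun x => (x 0).1.1 < (x 1).1.1
    | .lt₂ => fun x => (x 0).1.2 < (x 1).1.2

/-- `π ⊨ φ`. -/
def Satisfies {n : ℕ} (π : Equiv.Perm (Fin n)) (φ : twoOrders.Sentence) : Prop :=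
  @FirstOrder.Language.Sentence.Realize twoOrders (diagram π) (permStructure π) φ

/-- A set of permutations is definable by a first-order sentence in the theory of two orders. -/
def IsFODefinable (C : Set (Σ n : ℕ, Equiv.Perm (Fin n))) : Prop :=
  ∃ φ : twoOrders.Sentence, ∀ (n : ℕ) (π : Equiv.Perm (Fin n)),
    Satisfies π φ ↔ (⟨n, π⟩ : Σ n : ℕ, Equiv.Perm (Fin n)) ∈ C

end PermLogic

/-! A permutation lies in the merge exactly when its points have a two-colouring without a
monochromatic copy of α (`mem_merge_Av_iff`). For every `N` a finite point set is built which has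
such a colouring if `N` is odd (`Frame.colorable`) and none if `N` is even (`Frame.not_colorable`).
The sets for `N` and `N + 1` with `N = 8 * 2 ^ r` cannot be told apart by sentences of quantifier
rank at most `r` (`Frame.backForth_succ`, `realize_iff_of_backForth`), so a defining sentence would
have to detect the parity of a long chain.

The set is a chain of nested copies of the pattern. Level 0, the core, is one copy. In each higher
level one position, the gap, holds all lower levels, and another one, the cutter, is shifted so that
it lies on the side of a lower point required by the pattern only for selected points. Some
positions are single points; the others are replaced by a whole copy of the pattern, hence show both
colours and impose no constraint. If the gap is played by a selected point `u`, a copy arises, so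
some single point of the level differs in colour from `u` (`Frame.exists_single_ne`). Apart from the
leftmost core point, the points selected by a level are the single points of the level below, so
colours alternate along the chain. The outer level also selects the leftmost core point, which
closes a cycle of constraints that is consistent for one parity only.

That there are no harmful unintended copies rests on simplicity in the form `IntervalFree`: if a
copy is mapped to positions so that the fibres are intervals of the pattern, the map is constant or
injective (`IntervalFree.constant_or_injective`). -/

namespace PermLogic

open Function

/-! ### Merges as two-colourings without monochromatic copies -/

/-- `f` embeds the pattern with coordinates `x`, `y` into the point set with coordinates
`X`, `Y`. -/
def IsCopy {ι P A B V W : Type*} [LT A] [LT B] [LT V] [LT W] (x : ι → A) (y : ι → B)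
    (X : P → V) (Y : P → W) (f : ι → P) : Prop :=
  ∀ i j, (X (f i) < X (f j) ↔ x i < x j) ∧ (Y (f i) < Y (f j) ↔ y i < y j)

theorem exists_rank_equiv {P V : Type*} [Finite P] [LinearOrder V] (X : P → V)
    (hX : Injective X) : ∃ e : P ≃ Fin (Nat.card P), ∀ a b, e a < e b ↔ X a < X b := by
  classical
  have := Fintype.ofFinite P
  let _ : LinearOrder P := LinearOrder.lift' X hX
  let e : Fin (Nat.card P) ≃o P := Fintype.orderIsoFinOfCardEq P (by simp)
  refine ⟨e.symm.toEquiv, fun a b => ?_⟩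
  exact e.symm.lt_iff_lt

theorem exists_perm_of_injective {P V W : Type*} [Finite P] [LinearOrder V] [LinearOrder W]
    (X : P → V) (Y : P → W) (hX : Injective X) (hY : Injective Y) :
    ∃ π : Equiv.Perm (Fin (Nat.card P)), ∃ e : P ≃ diagram π, ∀ a b,
      ((e a).1.1 < (e b).1.1 ↔ X a < X b) ∧ ((e a).1.2 < (e b).1.2 ↔ Y a < Y b) := by
  obtain ⟨ex, hex⟩ := exists_rank_equiv X hX
  obtain ⟨ey, hey⟩ := exists_rank_equiv Y hY
  refine ⟨ex.symm.trans ey, ⟨fun a => ⟨(ex a, ey a), by simp [diagram]⟩,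
    fun p => ex.symm p.1.1, fun a => by simp, ?_⟩, fun a b => ⟨hex a b, hey a b⟩⟩
  rintro ⟨⟨i, j⟩, h⟩
  simp only [diagram, Set.mem_ofPred_eq, Equiv.trans_apply] at h
  simp [h]

theorem contains_iff {n m : ℕ} (τ : Equiv.Perm (Fin n)) (σ : Equiv.Perm (Fin m)) :
    Contains τ σ ↔ ∃ f : Fin m → diagram τ,
      IsCopy id σ (fun p => p.1.1) (fun p => p.1.2) f := by
  constructor
  · rintro ⟨S, hS, g, hg⟩
    refine ⟨fun i => Set.inclusion hS (g.symm ⟨(i, σ i), rfl⟩), fun i j => ?_⟩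
    have := hg (g.symm ⟨(i, σ i), rfl⟩) (g.symm ⟨(j, σ j), rfl⟩)
    simpa using this
  · rintro ⟨f, hf⟩
    have hinj : Injective (fun i => (f i : Fin n × Fin n)) := by
      intro i j hij
      have h1 := (hf i j).1
      have h2 := (hf j i).1
      simp only [id] at h1 h2 hij
      rw [hij] at h1 h2
      simp only [lt_self_iff_false, false_iff, not_lt] at h1 h2
      exact le_antisymm h2 h1
    refine ⟨Set.range fun i => (f i : Fin n × Fin n), ?_, ?_⟩
    · rintro _ ⟨i, rfl⟩
      exact (f i).2
    · let d : Fin m ≃ diagram σ := ⟨fun i => ⟨(i, σ i), rfl⟩, fun p => p.1.1, fun i => rfl, by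
        rintro ⟨⟨i, j⟩, h⟩
        simp only [diagram, Set.mem_ofPred_eq] at h
        simp [h]⟩
      refine ⟨(Equiv.ofInjective _ hinj).symm.trans d, ?_⟩
      intro p q
      obtain ⟨i, rfl⟩ := (Equiv.ofInjective _ hinj).surjective p
      obtain ⟨j, rfl⟩ := (Equiv.ofInjective _ hinj).surjective q
      simpa [d] using hf i j

theorem mem_merge_Av_iff {n N : ℕ} (hn : 0 < n) (α : Equiv.Perm (Fin n))
    (π : Equiv.Perm (Fin N)) {P V W : Type*} [Finite P] [LinearOrder V] [LinearOrder W]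
    (X : P → V) (Y : P → W) (e : P ≃ diagram π)
    (he : ∀ a b, ((e a).1.1 < (e b).1.1 ↔ X a < X b) ∧ ((e a).1.2 < (e b).1.2 ↔ Y a < Y b)) :
    (⟨N, π⟩ : Σ n : ℕ, Equiv.Perm (Fin n)) ∈ merge (Av α) (Av α) ↔
      ∃ c : P → Bool, ∀ f : Fin n → P, IsCopy id α X Y f → ∃ i j, c (f i) ≠ c (f j) := by
  classical
  have key : ∀ (S : Set (Fin N × Fin N)) {k : ℕ} (σ : Equiv.Perm (Fin k)),
      Isomorphic S (diagram σ) → (⟨k, σ⟩ : Σ n : ℕ, Equiv.Perm (Fin n)) ∈ Av α →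
      ∀ f : Fin n → P, IsCopy id α X Y f → ¬ ∀ i, (e (f i) : Fin N × Fin N) ∈ S := by
    rintro S k σ ⟨g, hg⟩ hσ f hf hS
    refine hσ ((contains_iff _ _).2 ⟨fun i => g ⟨e (f i), hS i⟩, fun i j => ?_⟩)
    have h1 := hg ⟨e (f i), hS i⟩ ⟨e (f j), hS j⟩
    have h2 := he (f i) (f j)
    have h3 := hf i j
    exact ⟨h1.1.symm.trans (h2.1.trans h3.1), h1.2.symm.trans (h2.2.trans h3.2)⟩
  constructor
  · rintro ⟨⟨k, σ⟩, hσ, ⟨l, τ⟩, hτ, red, blue, hu, hd, hr, hb⟩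
    refine ⟨fun a => decide ((e a : Fin N × Fin N) ∈ red), fun f hf => ?_⟩
    by_contra! hc
    by_cases h0 : (e (f ⟨0, hn⟩) : Fin N × Fin N) ∈ red
    · refine key red σ hr hσ f hf fun i => ?_
      simpa [h0] using hc i ⟨0, hn⟩
    · refine key blue τ hb hτ f hf fun i => ?_
      have h1 : (e (f i) : Fin N × Fin N) ∉ red := by simpa [h0] using hc i ⟨0, hn⟩
      have h2 : (e (f i) : Fin N × Fin N) ∈ red ∪ blue := by rw [hu]; exact (e (f i)).2
      exact h2.resolve_left h1
  · rintro ⟨c, hc⟩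
    have hX : Injective X := by
      intro a b hab
      have h1 := (he a b).1
      have h2 := (he b a).1
      rw [hab] at h1 h2
      simp only [lt_self_iff_false, iff_false, not_lt] at h1 h2
      have h3 : (e a).1.1 = (e b).1.1 := le_antisymm h2 h1
      refine e.injective (Subtype.ext (Prod.ext h3 ?_))
      have ha : (e a).1.2 = π (e a).1.1 := (e a).2
      have hb : (e b).1.2 = π (e b).1.1 := (e b).2
      exact ha.trans ((congrArg π h3).trans hb.symm)
    have hY : Injective Y := by
      intro a b hab
      have h1 := (he a b).2
      have h2 := (he b a).2
      rw [hab] at h1 h2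
      simp only [lt_self_iff_false, iff_false, not_lt] at h1 h2
      have h3 : (e a).1.2 = (e b).1.2 := le_antisymm h2 h1
      refine e.injective (Subtype.ext (Prod.ext ?_ h3))
      have ha : (e a).1.2 = π (e a).1.1 := (e a).2
      have hb : (e b).1.2 = π (e b).1.1 := (e b).2
      exact π.injective (ha.symm.trans (h3.trans hb))
    have part : ∀ b : Bool, ∃ k, ∃ σ : Equiv.Perm (Fin k),
        (⟨k, σ⟩ : Σ n : ℕ, Equiv.Perm (Fin n)) ∈ Av α ∧
        Isomorphic ((fun a => (e a : Fin N × Fin N)) '' {a | c a = b}) (diagram σ) := by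
      intro b
      obtain ⟨σ, d, hd⟩ := exists_perm_of_injective (P := {a // c a = b}) (fun a => X a.1)
        (fun a => Y a.1) (hX.comp Subtype.val_injective) (hY.comp Subtype.val_injective)
      refine ⟨_, σ, ?_, ?_⟩
      · intro hcon
        obtain ⟨f, hf⟩ := (contains_iff _ _).1 hcon
        have hcopy : IsCopy id α X Y fun i => (d.symm (f i)).1 := by
          intro i j
          have h1 := hd (d.symm (f i)) (d.symm (f j))
          simp only [Equiv.apply_symm_apply] at h1
          exact ⟨h1.1.symm.trans (hf i j).1, h1.2.symm.trans (hf i j).2⟩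
        obtain ⟨i, j, hij⟩ := hc _ hcopy
        exact hij ((d.symm (f i)).2.trans (d.symm (f j)).2.symm)
      · have hinj : Injective fun a => (e a : Fin N × Fin N) :=
          Subtype.val_injective.comp e.injective
        let g := Equiv.Set.image (fun a => (e a : Fin N × Fin N)) {a | c a = b} hinj
        refine ⟨g.symm.trans d, fun p q => ?_⟩
        obtain ⟨a, rfl⟩ := g.surjective p
        obtain ⟨a', rfl⟩ := g.surjective q
        have h1 := hd a a'
        have h2 := he a.1 a'.1
        simp only [Equiv.trans_apply, Equiv.symm_apply_apply]
        exact ⟨h2.1.trans h1.1.symm, h2.2.trans h1.2.symm⟩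
    obtain ⟨k, σ, hσ, hr⟩ := part true
    obtain ⟨l, τ, hτ, hb⟩ := part false
    refine ⟨⟨k, σ⟩, hσ, ⟨l, τ⟩, hτ, _, _, ?_, ?_, hr, hb⟩
    · ext p
      constructor
      · rintro (⟨a, -, rfl⟩ | ⟨a, -, rfl⟩) <;> exact (e a).2
      · intro hp
        obtain ⟨a, ha⟩ := e.surjective ⟨p, hp⟩
        have hp' : (e a : Fin N × Fin N) = p := by rw [ha]
        cases h : c a
        · exact Or.inr ⟨a, h, hp'⟩
        · exact Or.inl ⟨a, h, hp'⟩
    · rw [Set.disjoint_left]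
      rintro _ ⟨a, ha, rfl⟩ ⟨b, hb, hab⟩
      have := e.injective (Subtype.ext hab)
      subst this
      simp only [Set.mem_ofPred_eq] at ha hb
      simp [ha] at hb

/-! ### Simple permutations have no nontrivial intervals -/

/-- No nontrivial set of indices is an interval in both coordinates. -/
def IntervalFree {ι A B : Type*} [LT A] [LT B] (x : ι → A) (y : ι → B) : Prop :=
  ∀ S : Set ι, (∀ z ∉ S, ∀ s ∈ S, ∀ t ∈ S, (x z < x s ↔ x z < x t) ∧ (y z < y s ↔ y z < y t)) →
    S.Subsingleton ∨ S = Set.univ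

theorem IsSimple.intervalFree {n : ℕ} {α : Equiv.Perm (Fin n)} (hα : IsSimple α) :
    IntervalFree (id : Fin n → Fin n) α := by
  classical
  intro S hS
  by_contra! hne
  obtain ⟨h1, h2⟩ := hne
  obtain ⟨s₀, hs₀, s₁, hs₁, hs⟩ := h1
  obtain ⟨o, ho⟩ := (Set.ne_univ_iff_exists_notMem S).1 h2
  apply hα
  -- Contracts the interval `S` to `s₀`. The fixed points of `rep` form the outer permutation, which
  -- loses `s₁`; the fibres form the blocks, and none of them contains both `s₀` and `o`, so
  -- everything is strictly shorter.
  let rep : Fin n → Fin n := fun z => if z ∈ S then s₀ else z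
  have hrep : ∀ z, rep (rep z) = rep z := fun z => by
    by_cases hz : z ∈ S <;> simp [rep, hz]
  let Q := {z : Fin n // rep z = z}
  obtain ⟨σ, e, he⟩ := exists_perm_of_injective (P := Q) (fun z => z.1) (fun z => α z.1)
    Subtype.val_injective (α.injective.comp Subtype.val_injective)
  let F : Fin (Nat.card Q) → Fin n := fun i => (e.symm ⟨(i, σ i), rfl⟩).1
  have hpart : ∀ i : Fin (Nat.card Q), ∃ m : ℕ, ∃ τ : Equiv.Perm (Fin m),
      ∃ d : {z : Fin n // rep z = F i} ≃ diagram τ, (0 < m ∧ m < n) ∧ ∀ a b,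
      ((d a).1.1 < (d b).1.1 ↔ a.1 < b.1) ∧ ((d a).1.2 < (d b).1.2 ↔ α a.1 < α b.1) := by
    intro i
    obtain ⟨τ, d, hd⟩ := exists_perm_of_injective (P := {z : Fin n // rep z = F i})
      (fun z => z.1) (fun z => α z.1)
      Subtype.val_injective (α.injective.comp Subtype.val_injective)
    refine ⟨_, τ, d, ⟨?_, ?_⟩, hd⟩
    · have : Nonempty {z : Fin n // rep z = F i} := ⟨⟨F i, (e.symm ⟨(i, σ i), rfl⟩).2⟩⟩
      exact Nat.card_pos
    · have : ∃ z, ¬ rep z = F i := by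
        by_contra! hall
        have ha := hall o
        have hb := hall s₀
        simp only [rep, ho, hs₀, if_true, if_false] at ha hb
        exact ho (by rw [ha, ← hb]; exact hs₀)
      obtain ⟨z, hz⟩ := this
      have := Fintype.card_subtype_lt (p := fun z => rep z = F i) hz
      simpa using this
  choose m τ d hm hd using hpart
  refine ⟨Nat.card Q, σ, m, τ, ?_, hm, ?_⟩
  · have hz : ¬ rep s₁ = s₁ := by simp [rep, hs₁, hs]
    have := Fintype.card_subtype_lt (p := fun z => rep z = z) hz
    simpa [Q] using this
  let ix : Fin n → Fin (Nat.card Q) := fun z => (e ⟨rep z, hrep z⟩).1.1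
  have hσ : ∀ z, (e ⟨rep z, hrep z⟩).1.2 = σ (ix z) := fun z => (e ⟨rep z, hrep z⟩).2
  have hF : ∀ z, F (ix z) = rep z := by
    intro z
    have : (⟨(ix z, σ (ix z)), rfl⟩ : diagram σ) = e ⟨rep z, hrep z⟩ :=
      Subtype.ext (Prod.ext rfl (hσ z).symm)
    simp only [F, this, Equiv.symm_apply_apply]
  have hixF : ∀ i z, rep z = F i → ix z = i := by
    intro i z hz
    have : (⟨rep z, hrep z⟩ : Q) = e.symm ⟨(i, σ i), rfl⟩ := Subtype.ext hz
    simp only [ix, this, Equiv.apply_symm_apply]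
  let g : (z : Fin n) → diagram (τ (ix z)) := fun z => d (ix z) ⟨z, (hF z).symm⟩
  let G : Fin n → (Fin (Nat.card Q) ×ₗ ℕ) × (Fin (Nat.card Q) ×ₗ ℕ) := fun z =>
    (toLex (ix z, ((g z).1.1 : ℕ)), toLex (σ (ix z), ((g z).1.2 : ℕ)))
  have hG : ∀ z, G z ∈ inflationPoints σ m τ := fun z =>
    ⟨ix z, (g z).1.1, by
      have : (g z).1.2 = τ (ix z) (g z).1.1 := (g z).2
      simp only [G, this]⟩
  have hgg : ∀ i z z' (hz : rep z = F i) (hz' : rep z' = F i),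
      ((g z).1.1 : ℕ) = ((d i ⟨z, hz⟩).1.1 : ℕ) ∧ ((g z).1.2 : ℕ) = ((d i ⟨z, hz⟩).1.2 : ℕ) := by
    intro i z z' hz hz'
    obtain rfl := hixF i z hz
    exact ⟨rfl, rfl⟩
  -- Within a fibre the inner coordinates decide. Between fibres the outer ones do, since a point
  -- outside `S` compares with every point of `S` as it does with `s₀`.
  have hlt : ∀ z z', (z < z' ↔ (G z).1 < (G z').1) ∧ (α z < α z' ↔ (G z).2 < (G z').2) := by
    intro z z'
    by_cases hzz : rep z = rep z'
    · have e1 : ix z = ix z' := hixF _ _ (by rw [hF, hzz])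
      have h3 := hgg (ix z) z z (hF z).symm (hF z).symm
      have h4 := hgg (ix z) z' z' (by rw [hF, hzz]) (by rw [hF, hzz])
      have h5 := hd (ix z) ⟨z, (hF z).symm⟩ ⟨z', by rw [hF, hzz]⟩
      simp only [G, Prod.Lex.toLex_lt_toLex, e1, lt_self_iff_false, false_or, true_and, h3, h4,
        Fin.val_fin_lt]
      rw [← h3.1, ← h3.2] at *
      exact ⟨h5.1.symm, h5.2.symm⟩
    · have e0 : ix z ≠ ix z' := fun h => hzz (by rw [← hF, ← hF, h])
      have e1 : σ (ix z) ≠ σ (ix z') := fun h => e0 (σ.injective h)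
      have h3 := he ⟨rep z, hrep z⟩ ⟨rep z', hrep z'⟩
      rw [hσ, hσ] at h3
      simp only [G, Prod.Lex.toLex_lt_toLex, e0, e1, false_and, or_false]
      have h4 : (z < z' ↔ rep z < rep z') ∧ (α z < α z' ↔ α (rep z) < α (rep z')) := by
        have hne : z ≠ z' := fun h => hzz (by rw [h])
        by_cases hz : z ∈ S <;> by_cases hz' : z' ∈ S
        · exact absurd (by simp [rep, hz, hz']) hzz
        · have := hS z' hz' z hz s₀ hs₀
          have hne' : s₀ ≠ z' := fun h => hz' (h ▸ hs₀)
          simp only [rep, hz, hz', if_true, if_false]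
          simp only [id] at this
          constructor
          · rw [← not_iff_not, not_lt, not_lt, le_iff_lt_or_eq, le_iff_lt_or_eq, this.1]
            simp [hne.symm, hne'.symm]
          · rw [← not_iff_not, not_lt, not_lt, le_iff_lt_or_eq, le_iff_lt_or_eq, this.2]
            simp [hne.symm, hne'.symm]
        · have := hS z hz z' hz' s₀ hs₀
          simpa [rep, hz, hz'] using this
        · simp [rep, hz, hz']
      exact ⟨h4.1.trans h3.1.symm, h4.2.trans h3.2.symm⟩
  have hGinj : Injective G := by
    intro z z' h
    by_contra hne
    rcases lt_or_gt_of_ne hne with h5 | h5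
    · have := (hlt _ _).1.1 h5; rw [h] at this; exact lt_irrefl _ this
    · have := (hlt _ _).1.1 h5; rw [h] at this; exact lt_irrefl _ this
  let D : diagram α ≃ Fin n := ⟨fun p => p.1.1, fun i => ⟨(i, α i), rfl⟩, by
    rintro ⟨⟨i, j⟩, h⟩
    simp only [diagram, Set.mem_ofPred_eq] at h
    simp [h], fun i => rfl⟩
  let E : diagram α → inflationPoints σ m τ := fun p => ⟨G (D p), hG _⟩
  have hE : Bijective E := by
    constructor
    · intro p q h
      exact D.injective (hGinj (congrArg Subtype.val h))
    · rintro ⟨q, i, a, hq⟩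
      let z := (d i).symm ⟨(a, τ i a), rfl⟩
      have hz : ix z.1 = i := hixF i z.1 z.2
      refine ⟨D.symm z.1, Subtype.ext ?_⟩
      simp only [E, Equiv.apply_symm_apply, hq, G]
      have h3 := hgg i z.1 z.1 z.2 z.2
      rw [h3.1, h3.2, hz]
      simp [z]
  refine ⟨Equiv.ofBijective E hE, fun p q => ?_⟩
  have h3 := hlt (D p) (D q)
  have hp : α (D p) = p.1.2 := p.2.symm
  have hq : α (D q) = q.1.2 := q.2.symm
  rw [hp, hq] at h3
  exact h3

end PermLogic

/-! ### Copies of an interval-free pattern inside an inflation -/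

namespace PermLogic

open Function

theorem eq_of_bijective_of_lt_iff {ι B : Type*} [Finite ι] [LinearOrder B] {y : ι → B}
    (hy : Injective y) {g : ι → ι} (hg : Bijective g) (h : ∀ i j, y i < y j ↔ y (g i) < y (g j))
    (i : ι) : g i = i := by
  let _ : LinearOrder ι := LinearOrder.lift' y hy
  let e : ι ≃o ι := ⟨Equiv.ofBijective g hg, by
    intro a b
    have := h b a
    exact (not_lt.symm.trans ((not_congr this.symm).trans not_lt))⟩
  have : e = OrderIso.refl ι := Subsingleton.elim _ _
  exact DFunLike.congr_fun this i

/-- `H` says that every fibre of `g` is an interval in both coordinates, so each fibre is a single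
index or everything. -/
theorem IntervalFree.constant_or_injective {ι A B : Type*} [LT A] [LT B] {x : ι → A}
    {y : ι → B} (hf : IntervalFree x y) {κ : Type*} [Nonempty κ] (g : ι → κ)
    (H : ∀ i j z, g i = g j → g z ≠ g i →
      (x z < x i ↔ x z < x j) ∧ (y z < y i ↔ y z < y j)) :
    (∃ k, ∀ i, g i = k) ∨ Injective g := by
  by_cases hc : ∃ k, ∀ i, g i = k
  · exact Or.inl hc
  right
  intro i j hij
  rcases hf {z | g z = g i} (fun z hz s hs t ht => by
    rw [Set.mem_ofPred_eq] at hz hs ht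
    exact H s t z (hs.trans ht.symm) (by rw [hs]; exact hz)) with h | h
  · exact h rfl hij.symm
  · exact absurd ⟨g i, fun k => by
      have : k ∈ {z | g z = g i} := by rw [h]; trivial
      exact this⟩ hc

/-- A copy of a pattern without intervals inside a pattern one of whose points `p` has been
inflated, where the inflating set is cut by the neighbour `q` of `p`. -/
theorem IntervalFree.constant_or_exists_cut {ι A B : Type*} [Finite ι] [LinearOrder A]
    [LinearOrder B] {x : ι → A} {y : ι → B} (hx : Injective x) (hy : Injective y)
    (hf : IntervalFree x y) (g : ι → ι) {p q : ι} (hpq : p ≠ q) (U : Set ι)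
    (H1 : ∀ i j, g i ≠ g j → ¬ (g i = p ∧ g j = q) → ¬ (g i = q ∧ g j = p) →
      (x i < x j ↔ x (g i) < x (g j)))
    (H2 : ∀ i j, g i ≠ g j → (y i < y j ↔ y (g i) < y (g j)))
    (H3 : ∀ i j, g i = q → g j = p → ((x i < x j ↔ x q < x p) ↔ j ∈ U)) :
    (∃ k, ∀ i, g i = k) ∨ ∃ i j, g i = q ∧ g j = p ∧ j ∈ U := by
  by_cases hU : ∃ i j, g i = q ∧ g j = p ∧ j ∈ U
  · exact Or.inr hU
  left
  push Not at hU
  have hflip : ∀ {i j : ι}, i ≠ j → (x j < x i ↔ ¬ x i < x j) := fun {i j} hij => by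
    rw [not_lt, le_iff_lt_or_eq]
    simp [hx.ne hij.symm]
  -- If the cutter cuts off no point of the copy, roles `q` and `p` occur only in the order opposite
  -- to the pattern. The comparison then depends on the roles alone, so the fibres of `g` are
  -- intervals.
  have hqp : ∀ i j, g i = q → g j = p → (x i < x j ↔ x p < x q) := by
    intro i j hi hj
    have h1 := (not_congr (H3 i j hi hj)).2 (hU i j hi hj)
    rw [hflip hpq.symm]
    tauto
  have : Nonempty ι := ⟨p⟩
  rcases hf.constant_or_injective g (fun i j z hij hz => by
    have hzi : z ≠ i := fun h => hz (by rw [h])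
    have hzj : z ≠ j := fun h => hz (by rw [h, hij])
    refine ⟨?_, ?_⟩
    · by_cases c1 : g z = p ∧ g i = q
      · rw [hflip hzi.symm, hflip hzj.symm, hqp i z c1.2 c1.1, hqp j z (hij ▸ c1.2) c1.1]
      · by_cases c2 : g z = q ∧ g i = p
        · rw [hqp z i c2.1 c2.2, hqp z j c2.1 (hij ▸ c2.2)]
        · rw [H1 z i hz c1 c2, H1 z j (hij ▸ hz) (hij ▸ c1) (hij ▸ c2), hij]
    · rw [H2 z i hz, H2 z j (hij ▸ hz), hij]) with h | h
  · exact h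
  -- An injective `g` preserves the order by `y`, hence is the identity; then `hqp` reverses `q` and
  -- `p` themselves.
  · have hid := eq_of_bijective_of_lt_iff hy (Finite.injective_iff_bijective.1 h) (fun i j => by
      by_cases hij : i = j
      · simp [hij]
      · exact H2 i j (h.ne hij))
    have h1 := hqp q p (hid q) (hid p)
    exfalso
    rcases lt_or_gt_of_ne (hx.ne hpq) with h2 | h2
    · exact lt_asymm h2 (h1.2 h2)
    · exact lt_asymm h2 (h1.1 h2)

/-! ### The nested chain and its coordinates -/

/-- The data of a pattern from which the nested chains are built. -/
structure Frame (n : ℕ) where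
  h : Fin n → ℤ
  inj : Injective h
  free : IntervalFree (id : Fin n → Fin n) h
  four_le : 4 ≤ n
  o : Fin n
  l : Fin n
  o_val : o.1 = 0
  l_val : l.1 = 1
  l_lt_o : h l < h o
  p : Fin n
  q : Fin n
  q_lt_p : q.1 < p.1
  hq_lt_hp : h q < h p
  not_between : ∀ k, h k ≤ h q ∨ h p ≤ h k

namespace Frame

variable {n : ℕ} (T : Frame n) (N : ℕ)

/-- The position of the pattern which is inflated by the lower levels. -/
def gap (i : ℕ) : Fin n := if i = N + 2 then T.p else if i = N + 3 then T.o else T.l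

/-- The position of the point which cuts the lower levels. -/
def cutter (i : ℕ) : Fin n := if i = N + 2 then T.q else if i = N + 3 then T.l else T.o

/-- The positions which are not inflated by a copy of the pattern. -/
def IsSingle (i : ℕ) (k : Fin n) : Prop :=
  if i = 0 then k.1 ≠ 1 else if i = N + 3 then k.1 = 1 else
    if i = N + 2 then k.1 < T.p.1 else if i = N + 1 then T.h T.o ≤ T.h k else 2 ≤ k.1

/-- A triple is (level, position, place inside the block). Only the core keeps its gap position. At
a single position the last entry carries no information and is fixed to `T.o`. -/
def IsPoint (a : ℕ × Fin n × Fin n) : Prop :=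
  a.1 ≤ N + 3 ∧ (a.1 = 0 ∨ a.2.1 ≠ T.gap N a.1) ∧ (T.IsSingle N a.1 a.2.1 → a.2.2 = T.o)

/-- The points of the chain with `N + 4` nested levels. -/
abbrev Point : Type := {a : ℕ × Fin n × Fin n // T.IsPoint N a}

/-- The major coordinate is the level, signed by the side of the gap, so that higher levels surround
lower ones. The exceptions are the horizontal cutters: position 0 of level `i` moves into level `i -
1` for `1 ≤ i ≤ N + 1`, and position 1 of the outer level moves into the core. -/
def xMaj (i : ℕ) (k : Fin n) : ℤ :=
  if i = 0 then 0 else if i = N + 3 then (if k.1 = 1 then 0 else N + 3) else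
    if i = N + 2 then (if k.1 < T.p.1 then -(N + 2) else N + 2) else
      if k.1 = 0 then i - 1 else i

/-- Ordinary positions get even values, so the values 3 and 1 of the cutters fall between positions
1 and 2, and between positions 0 and 1, of the level they enter. -/
def xMin (i : ℕ) (k : Fin n) : ℤ :=
  if i = 0 then 2 * k.1 else if i = N + 3 then (if k.1 = 1 then 1 else 2 * k.1) else
    if i = N + 2 then 2 * k.1 else if k.1 = 0 then 3 else 2 * k.1

/-- Only the cutter `q` of level `N + 2` moves vertically: it enters level `N + 1`, and the odd
value in `yMin` puts it just below position `o` there. -/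
def yMaj (i : ℕ) (k : Fin n) : ℤ :=
  if i = N + 2 ∧ k.1 = T.q.1 then N + 1 else if T.h (T.gap N i) < T.h k then i else -i

def yMin (i : ℕ) (k : Fin n) : ℤ :=
  if i = N + 2 ∧ k.1 = T.q.1 then 2 * T.h T.o - 1 else 2 * T.h k

def X (a : T.Point N) : ℤ ×ₗ ℤ ×ₗ ℤ :=
  toLex (T.xMaj N a.1.1 a.1.2.1, toLex (xMin N a.1.1 a.1.2.1, (a.1.2.2.1 : ℤ)))

def Y (a : T.Point N) : ℤ ×ₗ ℤ ×ₗ ℤ :=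
  toLex (T.yMaj N a.1.1 a.1.2.1, toLex (T.yMin N a.1.1 a.1.2.1, T.h a.1.2.2))

variable {N}

theorem X_lt_iff (a b : T.Point N) : T.X N a < T.X N b ↔
    T.xMaj N a.1.1 a.1.2.1 < T.xMaj N b.1.1 b.1.2.1 ∨
    T.xMaj N a.1.1 a.1.2.1 = T.xMaj N b.1.1 b.1.2.1 ∧
      (xMin N a.1.1 a.1.2.1 < xMin N b.1.1 b.1.2.1 ∨
      xMin N a.1.1 a.1.2.1 = xMin N b.1.1 b.1.2.1 ∧ (a.1.2.2.1 : ℤ) < b.1.2.2.1) := by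
  simp [X, Prod.Lex.toLex_lt_toLex]

theorem Y_lt_iff (a b : T.Point N) : T.Y N a < T.Y N b ↔
    T.yMaj N a.1.1 a.1.2.1 < T.yMaj N b.1.1 b.1.2.1 ∨
    T.yMaj N a.1.1 a.1.2.1 = T.yMaj N b.1.1 b.1.2.1 ∧
      (T.yMin N a.1.1 a.1.2.1 < T.yMin N b.1.1 b.1.2.1 ∨
      T.yMin N a.1.1 a.1.2.1 = T.yMin N b.1.1 b.1.2.1 ∧ T.h a.1.2.2 < T.h b.1.2.2) := by
  simp [Y, Prod.Lex.toLex_lt_toLex]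

theorem Y_injective : Injective (T.Y N) := by
  rintro ⟨⟨i, k, s⟩, h1, h2, h3⟩ ⟨⟨j, m, t⟩, h4, h5, h6⟩ h
  simp only [Y, EmbeddingLike.apply_eq_iff_eq, Prod.mk.injEq] at h
  obtain ⟨e1, e2, e3⟩ := h
  have e4 := T.inj e3
  subst e4
  have hkm : k.1 ≠ m.1 → T.h k ≠ T.h m := fun e => T.inj.ne (fun e' => e (by rw [e']))
  have hq : ∀ k : Fin n, k.1 = T.q.1 → k = T.q := fun k e => Fin.ext e
  suffices i = j ∧ k.1 = m.1 by
    obtain ⟨rfl, e⟩ := this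
    have := Fin.ext e
    subst this
    rfl
  simp only [yMaj, yMin] at e1 e2
  by_cases hkm' : k.1 = m.1
  · have := Fin.ext hkm'
    subst this
    refine ⟨?_, rfl⟩
    split_ifs at e1 e2 <;> omega
  · have := hkm hkm'
    split_ifs at e1 e2 <;> omega

theorem X_injective : Injective (T.X N) := by
  rintro ⟨⟨i, k, s⟩, h1, h2, h3⟩ ⟨⟨j, m, t⟩, h4, h5, h6⟩ h
  simp only [X, EmbeddingLike.apply_eq_iff_eq, Prod.mk.injEq] at h
  obtain ⟨e1, e2, e3⟩ := h
  suffices i = j ∧ k.1 = m.1 by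
    obtain ⟨rfl, e⟩ := this
    have := Fin.ext e
    subst this
    have : s = t := Fin.ext (by omega)
    subst this
    rfl
  simp only [xMaj, xMin] at e1 e2
  simp only [ne_eq, Fin.ext_iff, gap] at h2 h5 h1 h4
  have := T.l_val
  have := T.o_val
  have := T.q_lt_p
  split_ifs at e1 e2 h2 h5 <;> omega

end Frame

end PermLogic

/-! ### Relative position of points from different levels -/

namespace PermLogic

open Function

namespace Frame

variable {n : ℕ} (T : Frame n) {N : ℕ}

/-- The position, in the copy of the pattern at level `i`, which is played by the point `a`. -/
def role (i : ℕ) (a : T.Point N) : Fin n := if a.1.1 = i then a.1.2.1 else T.gap N i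

/-- The set of the points which the cutter of level `i` cuts off from the lower levels. -/
def cutSet (N i : ℕ) : Set (T.Point N) :=
  {b | if i = N + 3 then (b.1.1 = N + 2 ∧ b.1.2.1.1 < T.p.1) ∨ (b.1.1 = 0 ∧ b.1.2.1.1 = 0) else
    if i = N + 2 then b.1.1 = N + 1 ∧ T.h T.o ≤ T.h b.1.2.1 else
      b.1.1 + 1 = i ∧ 2 ≤ b.1.2.1.1}

theorem h_ne {k m : Fin n} (hkm : k.1 ≠ m.1) : T.h k ≠ T.h m :=
  T.inj.ne (fun e => hkm (by rw [e]))

theorem xMaj_bounds {j : ℕ} {m : Fin n} :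
    T.xMaj N j m ≤ j ∧ -j ≤ T.xMaj N j m ∧ (j ≤ N + 1 → 0 ≤ T.xMaj N j m) := by
  unfold xMaj
  split_ifs <;> omega

theorem yMaj_bounds {j : ℕ} {m : Fin n} : T.yMaj N j m ≤ j ∧ -j ≤ T.yMaj N j m := by
  unfold yMaj
  split_ifs <;> omega

theorem X_same_level {a b : T.Point N} (hab : a.1.1 = b.1.1) (h : a.1.2.1.1 < b.1.2.1.1) :
    T.X N a < T.X N b := by
  have ha : b.1.1 = N + 3 → a.1.2.1.1 ≠ 0 := by
    intro e h0
    have h1 := a.2.2.1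
    have := T.o_val
    simp only [gap, hab, e, ne_eq, Fin.ext_iff] at h1
    simp at h1
    omega
  rw [X_lt_iff]
  simp only [xMaj, xMin, hab]
  split_ifs <;> omega

theorem Y_same_level {a b : T.Point N} (hab : a.1.1 = b.1.1)
    (h : T.h a.1.2.1 < T.h b.1.2.1) : T.Y N a < T.Y N b := by
  have hb := b.2.2.1
  have h1 := T.not_between a.1.2.1
  have h2 := T.not_between b.1.2.1
  have h3 : T.h a.1.2.1 = T.h T.p → a.1.2.1 = T.p := fun h => T.inj h
  have h4 : T.h b.1.2.1 = T.h T.p → b.1.2.1 = T.p := fun h => T.inj h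
  have ha := a.2.2.1
  have h5 : a.1.2.1.1 = T.q.1 → a.1.2.1 = T.q := fun e => Fin.ext e
  have h6 : b.1.2.1.1 = T.q.1 → b.1.2.1 = T.q := fun e => Fin.ext e
  have h7 := T.hq_lt_hp
  rw [Y_lt_iff]
  by_cases hi : b.1.1 = N + 2
  · simp only [gap, hab, hi, if_true] at ha hb
    simp only [yMaj, yMin, gap, hab, hi, if_true, true_and]
    have h8 : T.h a.1.2.1 ≠ T.h T.p := by
      intro e; rw [h3 e] at ha; simp at ha
    have h9 : T.h b.1.2.1 ≠ T.h T.p := by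
      intro e; rw [h4 e] at hb; simp at hb
    by_cases c1 : a.1.2.1.1 = T.q.1
    · have := h5 c1
      rw [this] at h
      by_cases c2 : b.1.2.1.1 = T.q.1
      · rw [h6 c2] at h; omega
      · simp only [c1, c2, if_true, if_false]
        split_ifs <;> omega
    · by_cases c2 : b.1.2.1.1 = T.q.1
      · rw [h6 c2] at h
        simp only [c1, c2, if_true, if_false]
        split_ifs <;> omega
      · simp only [c1, c2, if_false]
        split_ifs <;> omega
  · simp only [yMaj, yMin, hab, hi, false_and, if_false]
    split_ifs <;> omega

/-- The signed level dominates for all points except the horizontal cutters. At level `N + 2` no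
exception is needed, because that cutter is shifted only vertically. -/
theorem X_cross {a b : T.Point N} (hab : b.1.1 < a.1.1)
    (hc : a.1.1 ≠ N + 2 → a.1.2.1.1 ≠ (T.cutter N a.1.1).1) :
    (a.1.2.1.1 < (T.gap N a.1.1).1 → T.X N a < T.X N b) ∧
    ((T.gap N a.1.1).1 < a.1.2.1.1 → T.X N b < T.X N a) := by
  have hb := T.xMaj_bounds (N := N) (j := b.1.1) (m := b.1.2.1)
  have ha := a.2.1
  have := T.l_val
  have := T.o_val
  rw [X_lt_iff, X_lt_iff]
  have h0 : a.1.1 ≠ 0 := by omega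
  rcases (by omega : a.1.1 = N + 3 ∨ a.1.1 = N + 2 ∨ a.1.1 ≤ N + 1) with c | c | c
  · have e : T.gap N a.1.1 = T.o := by simp [gap, c]
    have e' : T.cutter N a.1.1 = T.l := by simp [cutter, c]
    rw [e] at *; rw [e'] at hc
    have : a.1.2.1.1 ≠ 1 := by omega
    have e2 : T.xMaj N a.1.1 a.1.2.1 = N + 3 := by simp [xMaj, c, this]
    omega
  · have e : T.gap N a.1.1 = T.p := by simp [gap, c]
    rw [e] at *
    constructor
    · intro h
      have e2 : T.xMaj N a.1.1 a.1.2.1 = -(N + 2) := by simp [xMaj, c, h]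
      omega
    · intro h
      have e2 : T.xMaj N a.1.1 a.1.2.1 = N + 2 := by simp [xMaj, c, h.not_gt]
      omega
  · have c1 : ¬ a.1.1 = N + 3 := by omega
    have c2 : ¬ a.1.1 = N + 2 := by omega
    have e : T.gap N a.1.1 = T.l := by simp [gap, c1, c2]
    have e' : T.cutter N a.1.1 = T.o := by simp [cutter, c1, c2]
    rw [e] at *; rw [e'] at hc
    have : a.1.2.1.1 ≠ 0 := by omega
    have e2 : T.xMaj N a.1.1 a.1.2.1 = a.1.1 := by simp [xMaj, c1, c2, h0, this]
    omega

theorem Y_cross {a b : T.Point N} (hab : b.1.1 < a.1.1)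
    (hc : a.1.1 = N + 2 → a.1.2.1.1 ≠ T.q.1) :
    (T.h a.1.2.1 < T.h (T.gap N a.1.1) → T.Y N a < T.Y N b) ∧
    (T.h (T.gap N a.1.1) < T.h a.1.2.1 → T.Y N b < T.Y N a) := by
  have hb := T.yMaj_bounds (N := N) (j := b.1.1) (m := b.1.2.1)
  rw [Y_lt_iff, Y_lt_iff]
  have : ¬ (a.1.1 = N + 2 ∧ a.1.2.1.1 = T.q.1) := fun h => hc h.1 h.2
  have e : T.yMaj N a.1.1 a.1.2.1 = if T.h (T.gap N a.1.1) < T.h a.1.2.1 then (a.1.1 : ℤ)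
    else -a.1.1 := by simp only [yMaj, this, if_false]
  rw [e]
  split_ifs <;> omega

/-- The left side says that the shifted cutter `a` still compares with `b` as the pattern demands;
`cutSet` collects the points for which it does. -/
theorem cut_X {a b : T.Point N} (hi : a.1.1 ≠ N + 2) (hb : b.1.1 < a.1.1)
    (hc : a.1.2.1 = T.cutter N a.1.1) :
    (T.X N a < T.X N b ↔ T.cutter N a.1.1 < T.gap N a.1.1) ↔ b ∈ T.cutSet N a.1.1 := by
  have hbd := T.xMaj_bounds (N := N) (j := b.1.1) (m := b.1.2.1)
  have ha := a.2.1
  have := T.l_val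
  have := T.o_val
  have hbv := b.2.2.1
  rw [X_lt_iff]
  have h0 : a.1.1 ≠ 0 := by omega
  by_cases c : a.1.1 = N + 3
  · have e : T.gap N a.1.1 = T.o := by simp [gap, c]
    have e' : T.cutter N a.1.1 = T.l := by simp [cutter, c]
    rw [hc, e, e', Fin.lt_def]
    simp only [cutSet, Set.mem_ofPred_eq]
    rw [if_pos c]
    have e1 : T.xMaj N a.1.1 T.l = 0 := by simp [xMaj, c, T.l_val]
    have e2 : xMin N a.1.1 T.l = 1 := by simp [xMin, c, T.l_val]
    rw [e1, e2]
    have hlt : ¬ (T.l.1 < T.o.1) := by omega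
    simp only [hlt, iff_false]
    simp only [xMaj, xMin]
    split_ifs <;> omega
  · have c1 : a.1.1 ≤ N + 1 := by omega
    have e : T.gap N a.1.1 = T.l := by simp [gap, c, hi]
    have e' : T.cutter N a.1.1 = T.o := by simp [cutter, c, hi]
    rw [hc, e, e', Fin.lt_def]
    simp only [cutSet, Set.mem_ofPred_eq]
    rw [if_neg c, if_neg hi]
    have e1 : T.xMaj N a.1.1 T.o = a.1.1 - 1 := by simp [xMaj, c, hi, h0, T.o_val]
    have e2 : xMin N a.1.1 T.o = 3 := by simp [xMin, c, hi, h0, T.o_val]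
    rw [e1, e2]
    have hlt : T.o.1 < T.l.1 := by omega
    have hg : b.1.1 ≠ 0 → b.1.2.1.1 ≠ 1 := by
      intro hb0
      have := hbv.resolve_left hb0
      have c2 : ¬ b.1.1 = N + 3 := by omega
      have c3 : ¬ b.1.1 = N + 2 := by omega
      simp only [gap, c2, c3, if_false, ne_eq, Fin.ext_iff] at this
      omega
    simp only [hlt, iff_true]
    simp only [xMaj, xMin]
    split_ifs <;> omega

theorem cut_Y {a b : T.Point N} (hi : a.1.1 = N + 2) (hb : b.1.1 < a.1.1)
    (hc : a.1.2.1 = T.q) :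
    (T.Y N a < T.Y N b ↔ T.h T.q < T.h T.p) ↔ b ∈ T.cutSet N (N + 2) := by
  have hbd := T.yMaj_bounds (N := N) (j := b.1.1) (m := b.1.2.1)
  have hlo := T.l_lt_o
  rw [Y_lt_iff]
  simp only [cutSet, Set.mem_ofPred_eq]
  have e1 : T.yMaj N a.1.1 a.1.2.1 = N + 1 := by simp [yMaj, hi, hc]
  have e2 : T.yMin N a.1.1 a.1.2.1 = 2 * T.h T.o - 1 := by simp [yMin, hi, hc]
  have hqp := T.hq_lt_hp
  rw [e1, e2]
  have c1 : ¬ b.1.1 = N + 2 := by omega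
  have c2 : ¬ N + 2 = N + 3 := by omega
  simp only [hqp, iff_true, c2, if_false, if_true]
  by_cases c : b.1.1 = N + 1
  · have c3 : ¬ b.1.1 = N + 3 := by omega
    have e : T.gap N b.1.1 = T.l := by simp [gap, c1, c3]
    simp only [yMaj, yMin, e, c1, false_and, if_false]
    split_ifs <;> omega
  · omega

end Frame

end PermLogic

/-! ### Copies in the chain, and forced colours for even `N` -/

namespace PermLogic

open Function

theorem IntervalFree.swap {ι A B : Type*} [LT A] [LT B] {x : ι → A} {y : ι → B}
    (hf : IntervalFree x y) : IntervalFree y x :=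
  fun S hS => hf S fun z hz s hs t ht => (hS z hz s hs t ht).symm

theorem isCopy_of_lt {ι P A B V W : Type*} [LinearOrder A] [LinearOrder B] [LinearOrder V]
    [LinearOrder W] {x : ι → A} {y : ι → B} (hx : Injective x) (hy : Injective y) {X : P → V}
    {Y : P → W} {f : ι → P} (h1 : ∀ i j, x i < x j → X (f i) < X (f j))
    (h2 : ∀ i j, y i < y j → Y (f i) < Y (f j)) : IsCopy x y X Y f := by
  intro i j
  refine ⟨⟨fun h => ?_, h1 i j⟩, ⟨fun h => ?_, h2 i j⟩⟩
  · by_contra hc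
    rcases (not_lt.1 hc).lt_or_eq with h' | h'
    · exact lt_asymm h (h1 _ _ h')
    · rw [hx h'] at h; exact lt_irrefl _ h
  · by_contra hc
    rcases (not_lt.1 hc).lt_or_eq with h' | h'
    · exact lt_asymm h (h2 _ _ h')
    · rw [hy h'] at h; exact lt_irrefl _ h

theorem lt_iff_lt_of_ne {A V : Type*} [LinearOrder A] [LinearOrder V] {a b : A} {v w : V}
    (hab : a ≠ b) (h1 : a < b → v < w) (h2 : b < a → w < v) : v < w ↔ a < b := by
  rcases lt_or_gt_of_ne hab with h | h
  · exact ⟨fun _ => h, h1⟩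
  · exact ⟨fun h' => absurd (h2 h) h'.not_gt, fun h' => absurd h h'.not_gt⟩

namespace Frame

variable {n : ℕ} (T : Frame n) {N : ℕ}

theorem role_of_lt {i : ℕ} {a : T.Point N} (h : a.1.1 < i) : T.role i a = T.gap N i := by
  simp [role, h.ne]

theorem role_of_eq {i : ℕ} {a : T.Point N} (h : a.1.1 = i) : T.role i a = a.1.2.1 := by
  simp [role, h]

theorem ne_gap (a : T.Point N) (h : a.1.1 ≠ 0) : a.1.2.1 ≠ T.gap N a.1.1 :=
  fun e => a.2.2.1.resolve_left h (by rw [e])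

theorem role_eq_gap_iff {i : ℕ} (hi : i ≠ 0) {a : T.Point N} (h : a.1.1 ≤ i) :
    T.role i a = T.gap N i ↔ a.1.1 < i := by
  refine ⟨fun e => lt_of_le_of_ne h fun e' => ?_, T.role_of_lt⟩
  rw [T.role_of_eq e'] at e
  subst e'
  exact T.ne_gap a hi e

theorem X_lt_of_role_lt {i : ℕ} (hi : i ≠ 0) {a b : T.Point N} (ha : a.1.1 ≤ i)
    (hb : b.1.1 ≤ i) (hlt : T.role i a < T.role i b)
    (h : i ≠ N + 2 → ¬ (T.role i a = T.gap N i ∧ T.role i b = T.cutter N i) ∧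
      ¬ (T.role i a = T.cutter N i ∧ T.role i b = T.gap N i)) : T.X N a < T.X N b := by
  rcases ha.lt_or_eq with ha | ha <;> rcases hb.lt_or_eq with hb | hb
  · rw [T.role_of_lt ha, T.role_of_lt hb] at hlt
    exact absurd hlt (lt_irrefl _)
  · rw [T.role_of_lt ha, T.role_of_eq hb] at *
    subst hb
    exact (T.X_cross ha fun e e' => (h e).1 ⟨rfl, Fin.ext e'⟩).2 hlt
  · rw [T.role_of_lt hb, T.role_of_eq ha] at *
    subst ha
    exact (T.X_cross hb fun e e' => (h e).2 ⟨Fin.ext e', rfl⟩).1 hlt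
  · rw [T.role_of_eq hb, T.role_of_eq ha] at *
    exact T.X_same_level (ha.trans hb.symm) hlt

theorem Y_lt_of_role_lt {i : ℕ} (hi : i ≠ 0) {a b : T.Point N} (ha : a.1.1 ≤ i)
    (hb : b.1.1 ≤ i) (hlt : T.h (T.role i a) < T.h (T.role i b))
    (h : i = N + 2 → ¬ (T.role i a = T.gap N i ∧ T.role i b = T.q) ∧
      ¬ (T.role i a = T.q ∧ T.role i b = T.gap N i)) : T.Y N a < T.Y N b := by
  rcases ha.lt_or_eq with ha | ha <;> rcases hb.lt_or_eq with hb | hb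
  · rw [T.role_of_lt ha, T.role_of_lt hb] at hlt
    exact absurd hlt (lt_irrefl _)
  · rw [T.role_of_lt ha, T.role_of_eq hb] at *
    subst hb
    exact (T.Y_cross ha fun e e' => (h e).1 ⟨rfl, Fin.ext e'⟩).2 hlt
  · rw [T.role_of_lt hb, T.role_of_eq ha] at *
    subst ha
    exact (T.Y_cross hb fun e e' => (h e).2 ⟨Fin.ext e', rfl⟩).1 hlt
  · rw [T.role_of_eq hb, T.role_of_eq ha] at *
    exact T.Y_same_level (ha.trans hb.symm) hlt

theorem gap_ne_cutter (i : ℕ) : T.gap N i ≠ T.cutter N i := by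
  have := T.l_val
  have := T.o_val
  have := T.q_lt_p
  rw [ne_eq, Fin.ext_iff]
  unfold gap cutter
  split_ifs <;> omega

/-- A copy of the pattern in the levels up to `i` is contained in a single position of level `i`,
or in the lower levels, or contains the cutter of level `i` and a point which it cuts off. -/
theorem constant_role_or_exists_cut {f : Fin n → T.Point N}
    (hf : IsCopy (id : Fin n → Fin n) T.h (T.X N) (T.Y N) f) {i : ℕ} (hi : i ≠ 0)
    (hle : ∀ j, (f j).1.1 ≤ i) :
    (∃ k, ∀ j, T.role i (f j) = k) ∨
    ∃ j j', (f j).1.1 = i ∧ (f j).1.2.1 = T.cutter N i ∧ (f j').1.1 < i ∧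
      f j' ∈ T.cutSet N i := by
  have hcut : ∀ j, T.role i (f j) = T.cutter N i →
      (f j).1.1 = i ∧ (f j).1.2.1 = T.cutter N i := by
    intro j h
    rcases (hle j).lt_or_eq with h' | h'
    · rw [T.role_of_lt h'] at h
      exact absurd h (T.gap_ne_cutter i)
    · exact ⟨h', by rwa [T.role_of_eq h'] at h⟩
  suffices H : (∃ k, ∀ j, T.role i (f j) = k) ∨
      ∃ j j', T.role i (f j) = T.cutter N i ∧ T.role i (f j') = T.gap N i ∧
        j' ∈ {j | f j ∈ T.cutSet N i} by
    rcases H with h | ⟨j, j', h1, h2, h3⟩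
    · exact Or.inl h
    · exact Or.inr ⟨j, j', (hcut j h1).1, (hcut j h1).2,
        (T.role_eq_gap_iff hi (hle j')).1 h2, h3⟩
  by_cases hN : i = N + 2
  · have hc : T.cutter N i = T.q := by simp [cutter, hN]
    have hg : T.gap N i = T.p := by simp [gap, hN]
    -- This level is cut vertically, so the two coordinates exchange their parts.
    refine T.free.swap.constant_or_exists_cut T.inj injective_id (fun j => T.role i (f j))
      (T.gap_ne_cutter i) {j | f j ∈ T.cutSet N i} ?_ ?_ ?_
    · intro j j' hne h1 h2
      rw [← (hf j j').2]
      rw [hc] at h1 h2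
      exact lt_iff_lt_of_ne (T.inj.ne hne)
        (fun h => T.Y_lt_of_role_lt hi (hle _) (hle _) h fun _ => ⟨h1, h2⟩)
        (fun h => T.Y_lt_of_role_lt hi (hle _) (hle _) h fun _ =>
          ⟨fun h => h2 h.symm, fun h => h1 h.symm⟩)
    · intro j j' hne
      rw [← (hf j j').1]
      exact lt_iff_lt_of_ne hne
        (fun h => T.X_lt_of_role_lt hi (hle _) (hle _) h fun h => absurd hN h)
        (fun h => T.X_lt_of_role_lt hi (hle _) (hle _) h fun h => absurd hN h)
    · intro j j' h1 h2
      rw [← (hf j j').2, hc, hg]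
      have h3 := hcut j h1
      have h4 := (T.role_eq_gap_iff hi (hle j')).1 h2
      have := T.cut_Y (a := f j) (b := f j') (h3.1.trans hN) (h3.1 ▸ h4) (h3.2.trans hc)
      rw [← hN] at this
      exact this
  · refine T.free.constant_or_exists_cut injective_id T.inj (fun j => T.role i (f j))
      (T.gap_ne_cutter i) {j | f j ∈ T.cutSet N i} ?_ ?_ ?_
    · intro j j' hne h1 h2
      rw [← (hf j j').1]
      exact lt_iff_lt_of_ne hne
        (fun h => T.X_lt_of_role_lt hi (hle _) (hle _) h fun _ => ⟨h1, h2⟩)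
        (fun h => T.X_lt_of_role_lt hi (hle _) (hle _) h fun _ =>
          ⟨fun h => h2 h.symm, fun h => h1 h.symm⟩)
    · intro j j' hne
      rw [← (hf j j').2]
      exact lt_iff_lt_of_ne (T.inj.ne hne)
        (fun h => T.Y_lt_of_role_lt hi (hle _) (hle _) h fun h => absurd h hN)
        (fun h => T.Y_lt_of_role_lt hi (hle _) (hle _) h fun h => absurd h hN)
    · intro j j' h1 h2
      rw [← (hf j j').1]
      have h3 := hcut j h1
      have h4 := (T.role_eq_gap_iff hi (hle j')).1 h2
      obtain ⟨rfl, h5⟩ := h3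
      exact T.cut_X hN h4 h5

/-- A copy of the pattern at level `i`, in which the position of the gap is played by a point which
the cutter cuts off. -/
theorem isCopy_level {f : Fin n → T.Point N} {i : ℕ} (hi : i ≠ 0)
    (hf : ∀ k, k ≠ T.gap N i → (f k).1.1 = i ∧ (f k).1.2.1 = k)
    (hlt : (f (T.gap N i)).1.1 < i) (hu : f (T.gap N i) ∈ T.cutSet N i) :
    IsCopy (id : Fin n → Fin n) T.h (T.X N) (T.Y N) f := by
  have hrole : ∀ k, T.role i (f k) = k := by
    intro k
    by_cases hk : k = T.gap N i
    · subst hk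
      rw [T.role_of_lt hlt]
    · rw [T.role_of_eq (hf k hk).1, (hf k hk).2]
  have hle : ∀ k, (f k).1.1 ≤ i := by
    intro k
    by_cases hk : k = T.gap N i
    · subst hk
      exact hlt.le
    · exact (hf k hk).1.le
  have hc := hf _ (T.gap_ne_cutter i).symm
  refine isCopy_of_lt injective_id T.inj (fun k m hkm => ?_) (fun k m hkm => ?_)
  · have hkm : k < m := hkm
    by_cases hN : i = N + 2
    · exact T.X_lt_of_role_lt hi (hle _) (hle _) (by simpa only [hrole] using hkm)
        fun h => absurd hN h
    · have key := T.cut_X (a := f (T.cutter N i)) (b := f (T.gap N i)) (by rwa [hc.1])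
        (by rwa [hc.1]) (by rw [hc.2, hc.1])
      rw [hc.1] at key
      have key := key.2 hu
      by_cases h1 : k = T.gap N i ∧ m = T.cutter N i
      · obtain ⟨rfl, rfl⟩ := h1
        refine lt_of_le_of_ne (not_lt.1 fun h => ?_) (T.X_injective.ne fun h => ?_)
        · exact lt_asymm hkm (key.1 h)
        · rw [h, hc.1] at hlt; exact lt_irrefl _ hlt
      · by_cases h2 : k = T.cutter N i ∧ m = T.gap N i
        · obtain ⟨rfl, rfl⟩ := h2
          exact key.2 hkm
        · exact T.X_lt_of_role_lt hi (hle _) (hle _) (by simpa only [hrole] using hkm)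
            fun _ => by simp only [hrole]; exact ⟨h1, h2⟩
  · by_cases hN : i = N + 2
    · have hcq : T.cutter N i = T.q := by simp [cutter, hN]
      have hg : T.gap N i = T.p := by simp [gap, hN]
      have key := T.cut_Y (a := f (T.cutter N i)) (b := f (T.gap N i)) (by rwa [hc.1])
        (by rwa [hc.1]) (by rw [hc.2, hcq])
      rw [← hN] at key
      have key := (key.2 hu).2 T.hq_lt_hp
      by_cases h1 : k = T.gap N i ∧ m = T.q
      · rw [h1.1, h1.2, hg] at hkm
        exact absurd hkm T.hq_lt_hp.not_gt
      · by_cases h2 : k = T.q ∧ m = T.gap N i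
        · rwa [h2.1, h2.2, ← hcq]
        · exact T.Y_lt_of_role_lt hi (hle _) (hle _) (by simpa only [hrole] using hkm)
            fun _ => by simp only [hrole]; exact ⟨h1, h2⟩
    · exact T.Y_lt_of_role_lt hi (hle _) (hle _) (by simpa only [hrole] using hkm)
        fun h => absurd h hN

theorem X_lt_iff_role_zero {a b : T.Point N} (ha : a.1.1 = 0) (hb : b.1.1 = 0)
    (hab : a.1.2.1 ≠ b.1.2.1) : T.X N a < T.X N b ↔ a.1.2.1 < b.1.2.1 :=
  lt_iff_lt_of_ne hab (fun h => T.X_same_level (ha.trans hb.symm) h)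
    fun h => T.X_same_level (hb.trans ha.symm) h

theorem Y_lt_iff_role_zero {a b : T.Point N} (ha : a.1.1 = 0) (hb : b.1.1 = 0)
    (hab : a.1.2.1 ≠ b.1.2.1) : T.Y N a < T.Y N b ↔ T.h a.1.2.1 < T.h b.1.2.1 :=
  lt_iff_lt_of_ne (T.inj.ne hab) (fun h => T.Y_same_level (ha.trans hb.symm) h)
    fun h => T.Y_same_level (hb.trans ha.symm) h

theorem isCopy_zero {f : Fin n → T.Point N} (hf : ∀ k, (f k).1.1 = 0 ∧ (f k).1.2.1 = k) :
    IsCopy (id : Fin n → Fin n) T.h (T.X N) (T.Y N) f := by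
  refine isCopy_of_lt injective_id T.inj (fun k m hkm => ?_) (fun k m hkm => ?_)
  · exact T.X_same_level ((hf k).1.trans (hf m).1.symm) (by rw [(hf k).2, (hf m).2]; exact hkm)
  · exact T.Y_same_level ((hf k).1.trans (hf m).1.symm) (by rw [(hf k).2, (hf m).2]; exact hkm)

theorem isCopy_block {f : Fin n → T.Point N} {i : ℕ} {m : Fin n}
    (hf : ∀ k, (f k).1 = (i, m, k)) :
    IsCopy (id : Fin n → Fin n) T.h (T.X N) (T.Y N) f := by
  intro k k'
  rw [X_lt_iff, Y_lt_iff, hf, hf]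
  simp only [lt_self_iff_false, false_or, true_and, Nat.cast_lt, Fin.val_fin_lt, id, and_self]

/-- The block at a position that is not single is itself a copy, so both colours occur in it. -/
theorem exists_color_block {c : T.Point N → Bool}
    (hc : ∀ f : Fin n → T.Point N, IsCopy (id : Fin n → Fin n) T.h (T.X N) (T.Y N) f →
      ∃ i j, c (f i) ≠ c (f j)) {i : ℕ} {m : Fin n} (hi : i ≤ N + 3)
    (hm : i = 0 ∨ m ≠ T.gap N i) (hs : ¬ T.IsSingle N i m) (b : Bool) :
    ∃ a : T.Point N, a.1.1 = i ∧ a.1.2.1 = m ∧ c a = b := by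
  obtain ⟨j, j', h⟩ := hc (fun k => ⟨(i, m, k), hi, hm, fun h => absurd h hs⟩)
    (T.isCopy_block fun k => rfl)
  by_cases hb : c ⟨(i, m, j), hi, hm, fun h => absurd h hs⟩ = b
  · exact ⟨_, rfl, rfl, hb⟩
  · refine ⟨⟨(i, m, j'), hi, hm, fun h => absurd h hs⟩, rfl, rfl, ?_⟩
    revert h hb
    cases c ⟨(i, m, j), hi, hm, fun h => absurd h hs⟩ <;>
      cases c ⟨(i, m, j'), hi, hm, fun h => absurd h hs⟩ <;> cases b <;> simp

/-- Otherwise `u` in the gap, the single points, and suitably coloured points of the blocks would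
form a monochromatic copy. -/
theorem exists_single_ne {c : T.Point N → Bool}
    (hc : ∀ f : Fin n → T.Point N, IsCopy (id : Fin n → Fin n) T.h (T.X N) (T.Y N) f →
      ∃ i j, c (f i) ≠ c (f j)) {i : ℕ} (hi : i ≠ 0) (hi' : i ≤ N + 3) {u : T.Point N}
    (hlt : u.1.1 < i) (hu : u ∈ T.cutSet N i) :
    ∃ a : T.Point N, a.1.1 = i ∧ T.IsSingle N i a.1.2.1 ∧ c a ≠ c u := by
  by_contra! H
  have hsel : ∀ k, k ≠ T.gap N i → ∃ a : T.Point N, a.1.1 = i ∧ a.1.2.1 = k ∧ c a = c u := by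
    intro k hk
    by_cases hs : T.IsSingle N i k
    · let a : T.Point N := ⟨(i, k, T.o), hi', Or.inr hk, fun _ => rfl⟩
      exact ⟨a, rfl, rfl, H a rfl hs⟩
    · exact T.exists_color_block hc hi' (Or.inr hk) hs _
  have : Nonempty (T.Point N) := ⟨u⟩
  choose! F hF using hsel
  let f : Fin n → T.Point N := fun k => if k = T.gap N i then u else F k
  have hfu : f (T.gap N i) = u := by simp [f]
  have hfk : ∀ k, k ≠ T.gap N i → f k = F k := fun k hk => by simp [f, hk]
  have hcol : ∀ k, c (f k) = c u := by
    intro k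
    by_cases hk : k = T.gap N i
    · rw [hk, hfu]
    · rw [hfk k hk]; exact (hF k hk).2.2
  obtain ⟨j, j', h⟩ := hc f (T.isCopy_level hi (fun k hk => by
    rw [hfk k hk]; exact ⟨(hF k hk).1, (hF k hk).2.1⟩) (by rwa [hfu]) (by rwa [hfu]))
  exact h ((hcol j).trans (hcol j').symm)

/-- The colour of the outer cutter `z` determines the others: single points of level `N + 2` differ
from it, those of level `N + 1` agree with it, and from there on colours alternate downwards. For
even `N` the core positions from 2 on receive the colour opposite to `z`, as does core position 0
directly from the outer level; the block at position 1 completes a monochromatic core. -/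
theorem not_colorable (hN : Even N) (c : T.Point N → Bool) :
    ¬ ∀ f : Fin n → T.Point N, IsCopy (id : Fin n → Fin n) T.h (T.X N) (T.Y N) f →
      ∃ i j, c (f i) ≠ c (f j) := by
  intro hc
  have hl := T.l_val
  have ho := T.o_val
  have hlo : T.l ≠ T.o := fun h => by rw [h] at hl; omega
  let z : T.Point N := ⟨(N + 3, T.l, T.o), le_rfl, Or.inr (by simp [gap, hlo]), fun _ => rfl⟩
  have houter : ∀ u : T.Point N, u.1.1 < N + 3 → u ∈ T.cutSet N (N + 3) → c u = !c z := by
    intro u h1 h2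
    obtain ⟨a, ha1, ha2, ha3⟩ := T.exists_single_ne hc (by omega) le_rfl h1 h2
    have haz : a = z := by
      refine Subtype.ext (Prod.ext ha1 (Prod.ext ?_ ?_))
      · simp only [IsSingle] at ha2
        simp only [if_true, show ¬ N + 3 = 0 by omega, if_false] at ha2
        exact Fin.ext (ha2.trans hl.symm)
      · exact a.2.2.2 (by rw [ha1]; exact ha2)
    rw [haz] at ha3
    exact (Bool.eq_not_of_ne ha3.symm)
  have hclosing : ∀ u : T.Point N, u.1.1 < N + 2 → u ∈ T.cutSet N (N + 2) → c u = c z := by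
    intro u h1 h2
    obtain ⟨a, ha1, ha2, ha3⟩ := T.exists_single_ne hc (by omega) (by omega) h1 h2
    have := houter a (by omega) (by
      simp only [IsSingle] at ha2
      simp only [if_true, show ¬ N + 2 = 0 by omega, show ¬ N + 2 = N + 3 by omega,
        if_false] at ha2
      simp only [cutSet, Set.mem_ofPred_eq, if_true]
      exact Or.inl ⟨ha1, ha2⟩)
    rw [this] at ha3
    revert ha3
    cases c z <;> cases c u <;> simp
  have hchain : ∀ j, ∀ i, i + j = N → ∀ u : T.Point N, u.1.1 = i → 2 ≤ u.1.2.1.1 →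
      c u = if Even j then !c z else c z := by
    intro j
    induction j with
    | zero =>
      intro i hi u h1 h2
      simp only [add_zero] at hi
      obtain ⟨a, ha1, ha2, ha3⟩ := T.exists_single_ne hc (i := N + 1) (u := u) (by omega)
        (by omega) (by omega) (by
          simp only [cutSet, Set.mem_ofPred_eq, show ¬ N + 1 = N + 3 by omega,
            show ¬ N + 1 = N + 2 by omega, if_false]
          omega)
      have := hclosing a (by omega) (by
        simp only [IsSingle] at ha2
        simp only [if_true, show ¬ N + 1 = 0 by omega, show ¬ N + 1 = N + 3 by omega,
          show ¬ N + 1 = N + 2 by omega, if_false] at ha2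
        simp only [cutSet, Set.mem_ofPred_eq, show ¬ N + 2 = N + 3 by omega, if_true, if_false]
        exact ⟨ha1, ha2⟩)
      rw [this] at ha3
      simpa using Bool.eq_not_of_ne ha3.symm
    | succ j ih =>
      intro i hi u h1 h2
      obtain ⟨a, ha1, ha2, ha3⟩ := T.exists_single_ne hc (i := i + 1) (u := u) (by omega)
        (by omega) (by omega) (by
          simp only [cutSet, Set.mem_ofPred_eq, show ¬ i + 1 = N + 3 by omega,
            show ¬ i + 1 = N + 2 by omega, if_false]
          omega)
      have := ih (i + 1) (by omega) a ha1 (by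
        simpa only [IsSingle, show ¬ i + 1 = 0 by omega, show ¬ i + 1 = N + 3 by omega,
          show ¬ i + 1 = N + 2 by omega, show ¬ i + 1 = N + 1 by omega, if_false] using ha2)
      rw [this] at ha3
      revert ha3
      by_cases hj : Even j <;> cases c z <;> cases c u <;> simp [hj, Nat.even_add_one]
  have hcore : ∀ k, ∃ a : T.Point N, a.1.1 = 0 ∧ a.1.2.1 = k ∧ c a = !c z := by
    intro k
    by_cases hk : T.IsSingle N 0 k
    · let a : T.Point N := ⟨(0, k, T.o), by omega, Or.inl rfl, fun _ => rfl⟩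
      refine ⟨a, rfl, rfl, ?_⟩
      simp only [IsSingle, if_true] at hk
      rcases (by omega : k.1 = 0 ∨ 2 ≤ k.1) with h | h
      · refine houter a (show 0 < N + 3 by omega) ?_
        simp only [cutSet, Set.mem_ofPred_eq, if_true]
        exact Or.inr ⟨rfl, h⟩
      · have := hchain N 0 (by omega) a rfl h
        rwa [if_pos hN] at this
    · exact T.exists_color_block hc (by omega) (Or.inl rfl) hk _
  choose f hf using hcore
  obtain ⟨j, j', h⟩ := hc f (T.isCopy_zero fun k => ⟨(hf k).1, (hf k).2.1⟩)
  exact h ((hf j).2.2.trans (hf j').2.2.symm)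

end Frame

end PermLogic

/-! ### A good colouring for odd `N` -/

namespace PermLogic

open Function

theorem IsCopy.injective {ι P A B V W : Type*} [LinearOrder A] [LT B] [Preorder V]
    [LT W] {x : ι → A} {y : ι → B} {X : P → V} {Y : P → W} {f : ι → P} (hf : IsCopy x y X Y f)
    (hx : Injective x) : Injective f := by
  intro i j h
  have h1 := (hf i j).1
  have h2 := (hf j i).1
  rw [h] at h1 h2
  simp only [lt_self_iff_false, false_iff, not_lt] at h1 h2
  exact hx (le_antisymm h2 h1)

namespace Frame

variable {n : ℕ} (T : Frame n) {N : ℕ}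

open Classical in
-- Single points are coloured by the parity of their level, and in each block only `T.o` is `true`.
-- Core position 0 is exceptional, because it has to differ from the outer cutter, whose level `N +
-- 3` is even for odd `N`.
noncomputable def color (a : T.Point N) : Bool :=
  if T.IsSingle N a.1.1 a.1.2.1 then decide ((a.1.1 = 0 ∧ a.1.2.1.1 = 0) ∨ Odd a.1.1) else
    decide (a.1.2.2 = T.o)

theorem color_single {a : T.Point N} (h : T.IsSingle N a.1.1 a.1.2.1) :
    T.color a = true ↔ (a.1.1 = 0 ∧ a.1.2.1.1 = 0) ∨ Odd a.1.1 := by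
  rw [color, if_pos h]
  exact decide_eq_true_iff

/-- Such a copy fills the block, so it contains both the `true` point `o` and the `false` point `l`.
-/
theorem not_block {f : Fin n → T.Point N}
    (hf : IsCopy (id : Fin n → Fin n) T.h (T.X N) (T.Y N) f)
    (H : ∀ i j, T.color (f i) = T.color (f j)) {i : ℕ} {k : Fin n} (h1 : ∀ j, (f j).1.1 = i)
    (h2 : ∀ j, (f j).1.2.1 = k) : False := by
  have hinj : Injective fun j => (f j).1.2.2 := by
    intro j j' h
    exact hf.injective injective_id (Subtype.ext (Prod.ext ((h1 j).trans (h1 j').symm)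
      (Prod.ext ((h2 j).trans (h2 j').symm) h)))
  have hs := Finite.surjective_of_injective hinj
  obtain ⟨j, hj⟩ := hs T.o
  obtain ⟨j', hj'⟩ := hs T.l
  have hl := T.l_val
  have ho := T.o_val
  have hlo : T.l ≠ T.o := fun h => by rw [h] at hl; omega
  have hns : ¬ T.IsSingle N i k := by
    intro h
    have := (f j').2.2.2 (by rwa [h1, h2])
    exact hlo (hj'.symm.trans this)
  have := H j j'
  simp only at hj hj'
  rw [color, color, h1, h2, h1, h2, if_neg hns, if_neg hns, hj, hj'] at this
  simp [hlo] at this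

/-- A copy in the core lies in one block or uses every position; in the latter case positions 0 and
2 have different colours. -/
theorem not_core {f : Fin n → T.Point N}
    (hf : IsCopy (id : Fin n → Fin n) T.h (T.X N) (T.Y N) f)
    (H : ∀ i j, T.color (f i) = T.color (f j)) (h0 : ∀ j, (f j).1.1 = 0) : False := by
  have : Nonempty (Fin n) := ⟨T.o⟩
  have hX : ∀ i j, (f i).1.2.1 ≠ (f j).1.2.1 → (i < j ↔ (f i).1.2.1 < (f j).1.2.1) :=
    fun i j hij => (hf i j).1.symm.trans (T.X_lt_iff_role_zero (h0 i) (h0 j) hij)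
  have hY : ∀ i j, (f i).1.2.1 ≠ (f j).1.2.1 →
      (T.h i < T.h j ↔ T.h (f i).1.2.1 < T.h (f j).1.2.1) :=
    fun i j hij => (hf i j).2.symm.trans (T.Y_lt_iff_role_zero (h0 i) (h0 j) hij)
  rcases T.free.constant_or_injective (fun j => (f j).1.2.1) (fun i j z hij hz => by
    have hz' : (f z).1.2.1 ≠ (f j).1.2.1 := hij ▸ hz
    simp only [id]
    rw [hX z i hz, hX z j hz', hY z i hz, hY z j hz', hij]
    exact ⟨Iff.rfl, Iff.rfl⟩) with ⟨k, hk⟩ | h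
  · exact T.not_block hf H h0 hk
  · have hs := Finite.surjective_of_injective h
    obtain ⟨j, hj⟩ := hs T.o
    obtain ⟨j', hj'⟩ := hs ⟨2, by have := T.four_le; omega⟩
    simp only at hj hj'
    have ho := T.o_val
    have c1 : T.color (f j) = true := (T.color_single (by
      rw [hj, h0]; simp [IsSingle, ho])).2 (Or.inl ⟨h0 j, by rw [hj]; exact ho⟩)
    have c2 := (T.color_single (a := f j') (by
      rw [hj', h0]; simp [IsSingle])).1 ((H j' j).trans c1)
    rw [h0, hj'] at c2
    simp at c2

theorem isSingle_chain {a : T.Point N} (h : a.1.1 ≤ N) (h2 : 2 ≤ a.1.2.1.1) :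
    T.IsSingle N a.1.1 a.1.2.1 := by
  simp only [IsSingle, show ¬ a.1.1 = N + 3 by omega, show ¬ a.1.1 = N + 2 by omega,
    show ¬ a.1.1 = N + 1 by omega, if_false]
  split_ifs <;> omega

theorem color_chain {a : T.Point N} (h : a.1.1 ≤ N) (h2 : 2 ≤ a.1.2.1.1) :
    T.color a = true ↔ Odd a.1.1 := by
  rw [T.color_single (T.isSingle_chain h h2)]
  have : a.1.2.1.1 ≠ 0 := by omega
  simp [this]

theorem gap_chain {i : ℕ} (h : i ≤ N + 1) : T.gap N i = T.l := by
  simp [gap, show ¬ i = N + 3 by omega, show ¬ i = N + 2 by omega]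

theorem cutter_chain {i : ℕ} (h : i ≤ N + 1) : T.cutter N i = T.o := by
  simp [cutter, show ¬ i = N + 3 by omega, show ¬ i = N + 2 by omega]

theorem X_cutter_iff {a b : T.Point N} (hb : b.1.1 ≤ N + 1) (hb0 : b.1.2.1.1 = 0)
    (hab : a.1.1 < b.1.1) : T.X N b < T.X N a ↔ a.1.1 + 1 = b.1.1 ∧ 2 ≤ a.1.2.1.1 := by
  have h := T.cut_X (a := b) (b := a) (by omega) hab (by
    rw [T.cutter_chain hb]; exact Fin.ext (hb0.trans T.o_val.symm))
  have h1 : T.cutter N b.1.1 < T.gap N b.1.1 := by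
    rw [T.cutter_chain hb, T.gap_chain hb, Fin.lt_def, T.o_val, T.l_val]
    exact Nat.zero_lt_one
  simp only [h1, iff_true, cutSet, Set.mem_ofPred_eq, show ¬ b.1.1 = N + 3 by omega,
    show ¬ b.1.1 = N + 2 by omega, if_false] at h
  exact h

theorem X_lt_cutter {a b : T.Point N} (hb : b.1.1 ≤ N + 1) (hb0 : b.1.2.1.1 = 0)
    (hab : a.1.1 < b.1.1) (h : ¬ (a.1.1 + 1 = b.1.1 ∧ 2 ≤ a.1.2.1.1)) :
    T.X N a < T.X N b := by
  refine lt_of_le_of_ne (not_lt.1 fun h' => h ((T.X_cutter_iff hb hb0 hab).1 h'))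
    (T.X_injective.ne fun h => ?_)
  rw [h] at hab
  exact lt_irrefl _ hab

theorem Y_lt_cutter {a b : T.Point N} (hb : b.1.1 ≤ N + 1) (hb0 : b.1.2.1.1 = 0)
    (hab : a.1.1 < b.1.1) : T.Y N a < T.Y N b := by
  refine (T.Y_cross hab fun h => by omega).2 ?_
  rw [T.gap_chain hb, show b.1.2.1 = T.o from Fin.ext (hb0.trans T.o_val.symm)]
  exact T.l_lt_o

/-- In the levels up to `N` the cutter is a block, so its colour alone excludes nothing. Yet the
common colour, that of the single points of level `m`, rules out the single points of levels `m + 1`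
and `m - 1`, and what remains is too ordered from left to right to contain the pattern. -/
theorem not_chain {f : Fin n → T.Point N}
    (hf : IsCopy (id : Fin n → Fin n) T.h (T.X N) (T.Y N) f)
    (H : ∀ i j, T.color (f i) = T.color (f j)) {m : ℕ} (hm : m + 1 ≤ N)
    (hle : ∀ j, (f j).1.1 ≤ m + 1) (hc : ∃ j, (f j).1.1 = m + 1)
    (hu : ∃ j, (f j).1.1 = m ∧ 2 ≤ (f j).1.2.1.1) : False := by
  obtain ⟨u, hu1, hu2⟩ := hu
  obtain ⟨v, hv⟩ := hc
  have ho := T.o_val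
  have hl := T.l_val
  have hcol : ∀ j, T.color (f j) = true ↔ Odd m := by
    intro j
    rw [H j u, T.color_chain (by omega) hu2, hu1]
  have hgap : ∀ j, (f j).1.1 ≠ 0 → (f j).1.2.1.1 ≠ 1 := by
    intro j hj h
    have := T.ne_gap (f j) hj
    rw [T.gap_chain (by have := hle j; omega)] at this
    exact this (Fin.ext (h.trans hl.symm))
  -- Classes from left to right: 0 for the levels below `m`, 1 for the remaining block of level `m`,
  -- 2 for the cutter block of level `m + 1`, and `k + 1` for the single position `k` of level `m`.
  -- Classes 0, 1, 2 also increase in height.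
  let g : Fin n → ℕ := fun t => if (f t).1.1 < m then 0 else if (f t).1.1 = m + 1 then 2 else
    if (f t).1.2.1.1 < 2 then 1 else (f t).1.2.1.1 + 1
  have cls : ∀ t,
      ((f t).1.1 < m ∧ g t = 0 ∧ ¬ ((f t).1.1 + 1 = m ∧ 2 ≤ (f t).1.2.1.1)) ∨
      ((f t).1.1 = m ∧ g t = 1 ∧ (m = 0 → (f t).1.2.1.1 = 1) ∧ (m ≠ 0 → (f t).1.2.1.1 = 0)) ∨
      ((f t).1.1 = m + 1 ∧ g t = 2 ∧ (f t).1.2.1.1 = 0) ∨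
      ((f t).1.1 = m ∧ g t = (f t).1.2.1.1 + 1 ∧ 2 ≤ (f t).1.2.1.1) := by
    intro t
    have h1 := hle t
    have h2 := hgap t
    have h3 := hcol t
    rcases (by omega : (f t).1.1 < m ∨ (f t).1.1 = m ∧ (f t).1.2.1.1 < 2 ∨
      (f t).1.1 = m + 1 ∨ (f t).1.1 = m ∧ 2 ≤ (f t).1.2.1.1) with h | h | h | h
    · refine Or.inl ⟨h, by simp [g, h], fun h' => ?_⟩
      rw [T.color_chain (by omega) h'.2, ← h'.1, Nat.odd_add_one] at h3
      tauto
    · refine Or.inr (Or.inl ⟨h.1, by simp only [g]; split_ifs <;> omega, fun h0 => ?_, by omega⟩)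
      by_contra h4
      have h5 : (f t).1.2.1.1 = 0 := by omega
      rw [T.color_single (by simp [IsSingle, h.1, h0, h5])] at h3
      simp [h.1, h0, h5] at h3
    · refine Or.inr (Or.inr (Or.inl ⟨h, by simp [g, h], ?_⟩))
      by_contra h4
      rw [T.color_chain (by omega) (by omega), h, Nat.odd_add_one] at h3
      tauto
    · exact Or.inr (Or.inr (Or.inr ⟨h.1, by simp only [g]; split_ifs <;> omega, h.2⟩))
  have hX : ∀ s t, g s < g t → T.X N (f s) < T.X N (f t) := by
    intro s t hst
    rcases cls s with a | a | a | a <;> rcases cls t with b | b | b | b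
    all_goals first
      | (exfalso; omega)
      | exact T.X_lt_cutter (by omega) (by omega) (by omega) (by omega)
      | exact T.X_same_level (by omega) (by omega)
      | exact (T.X_cutter_iff (by omega) (by omega) (by omega)).2 (by omega)
      | exact (T.X_cross (by omega) fun _ => by
          rw [T.cutter_chain (by omega)]; omega).2 (by rw [T.gap_chain (by omega)]; omega)
  have hXg : ∀ s t, g s ≠ g t → (s < t ↔ g s < g t) := fun s t hst =>
    (hf s t).1.symm.trans (lt_iff_lt_of_ne hst (hX s t) (hX t s))
  have hY : ∀ s t, g s < g t → g t ≤ 2 → T.Y N (f s) < T.Y N (f t) := by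
    intro s t hst ht
    rcases cls s with a | a | a | a <;> rcases cls t with b | b | b | b
    all_goals first
      | (exfalso; omega)
      | exact T.Y_lt_cutter (by omega) (by omega) (by omega)
  have hhl : ∀ t, 2 ≤ (f t).1.2.1.1 → T.h (f t).1.2.1 ≠ T.h T.l := fun t ht =>
    T.h_ne (by omega)
  have hYconst : ∀ s t z, g s = g t → g z ≠ g s →
      (T.Y N (f z) < T.Y N (f s) ↔ T.Y N (f z) < T.Y N (f t)) := by
    intro s t z hst hz
    by_cases hs : 3 ≤ g s
    · have h1 : (f s).1.1 = m ∧ g s = (f s).1.2.1.1 + 1 ∧ 2 ≤ (f s).1.2.1.1 := by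
        have := cls s; omega
      have h2 : (f t).1.1 = m ∧ g t = (f t).1.2.1.1 + 1 ∧ 2 ≤ (f t).1.2.1.1 := by
        have := cls t; omega
      have e1 := (f s).2.2.2 (T.isSingle_chain (by omega) h1.2.2)
      have e2 := (f t).2.2.2 (T.isSingle_chain (by omega) h2.2.2)
      have : f s = f t := Subtype.ext (Prod.ext (h1.1.trans h2.1.symm)
        (Prod.ext (Fin.ext (by omega)) (e1.trans e2.symm)))
      rw [this]
    · by_cases h3 : 3 ≤ g z
      · have h1 : (f z).1.1 = m ∧ g z = (f z).1.2.1.1 + 1 ∧ 2 ≤ (f z).1.2.1.1 := by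
          have := cls z; omega
        rcases cls s with a | a | a | a <;> rcases cls t with b | b | b | b
        all_goals try (exfalso; omega)
        · have hs := T.Y_cross (a := f z) (b := f s) (by omega) (by omega)
          have ht := T.Y_cross (a := f z) (b := f t) (by omega) (by omega)
          rw [T.gap_chain (by omega)] at hs ht
          rw [lt_iff_lt_of_ne (hhl z h1.2.2) hs.1 hs.2, lt_iff_lt_of_ne (hhl z h1.2.2) ht.1 ht.2]
        · have hs : T.h (f z).1.2.1 ≠ T.h (f s).1.2.1 := T.h_ne (by omega)
          have ht : T.h (f z).1.2.1 ≠ T.h (f t).1.2.1 := T.h_ne (by omega)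
          rw [lt_iff_lt_of_ne hs (T.Y_same_level (by omega)) (T.Y_same_level (by omega)),
            lt_iff_lt_of_ne ht (T.Y_same_level (by omega)) (T.Y_same_level (by omega)),
            show (f s).1.2.1 = (f t).1.2.1 from Fin.ext (by omega)]
        · exact iff_of_true (T.Y_lt_cutter (by omega) (by omega) (by omega))
            (T.Y_lt_cutter (by omega) (by omega) (by omega))
      · rw [lt_iff_lt_of_ne hz (fun h => hY z s h (by omega)) (fun h => hY s z h (by omega)),
          lt_iff_lt_of_ne (hst ▸ hz) (fun h => hY z t h (by omega))
          (fun h => hY t z h (by omega)), hst]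
  rcases T.free.constant_or_injective g (fun s t z hst hz =>
    ⟨by simp only [id]; rw [hXg z s hz, hXg z t (hst ▸ hz), hst], by
      rw [← (hf z s).2, ← (hf z t).2]; exact hYconst s t z hst hz⟩) with ⟨k, hk⟩ | h
  · have h1 := hk u
    have h2 := hk v
    have h3 := cls u
    have h4 := cls v
    omega
  · have hol : g T.o < g T.l :=
      (hXg _ _ (h.ne fun e => by rw [e] at ho; omega)).1 (by rw [Fin.lt_def]; omega)
    have h3 : 3 ≤ g T.l := by
      by_contra hlt
      have := (hf T.o T.l).2.1 (hY _ _ hol (by omega))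
      exact lt_asymm this T.l_lt_o
    -- The descent from `o` to `l` cannot occur within the increasing classes 0, 1, 2, so `l` has
    -- class at least 3. Strict growth then gives the last index class at least `n + 1`, whereas the
    -- largest class is `n`.
    have key : ∀ k, 1 ≤ k → ∀ hk : k < n, k + 2 ≤ g ⟨k, hk⟩ := by
      intro k hk1
      induction k, hk1 using Nat.le_induction with
      | base =>
        intro hk
        rwa [show (⟨1, hk⟩ : Fin n) = T.l from Fin.ext hl.symm]
      | succ k hk1 ih =>
        intro hk
        have h5 := ih (by omega)
        have h6 := (hXg ⟨k, by omega⟩ ⟨k + 1, hk⟩ (h.ne (by simp))).1 (by simp [Fin.lt_def])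
        omega
    have hn := T.four_le
    have h7 := key (n - 1) (by omega) (by omega)
    have h8 := cls ⟨n - 1, by omega⟩
    have h9 := (f ⟨n - 1, by omega⟩).1.2.1.2
    omega

theorem colorable (hN : Odd N) {f : Fin n → T.Point N}
    (hf : IsCopy (id : Fin n → Fin n) T.h (T.X N) (T.Y N) f) :
    ∃ i j, T.color (f i) ≠ T.color (f j) := by
  by_contra! H
  have : Nonempty (Fin n) := ⟨T.o⟩
  obtain ⟨j₀, hj₀⟩ := Finite.exists_max fun j => (f j).1.1
  by_cases hi : (f j₀).1.1 = 0
  · exact T.not_core hf H fun j => by have := hj₀ j; omega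
  rcases T.constant_role_or_exists_cut hf hi hj₀ with ⟨k, hk⟩ | ⟨j, j', h1, h2, h3, h4⟩
  -- The constant role is not the gap, since `f j₀` itself lies on the top level.
  · have hlev : ∀ j, (f j).1.1 = (f j₀).1.1 := by
      intro j
      refine (hj₀ j).lt_or_eq.resolve_left fun h => ?_
      rw [← T.role_eq_gap_iff hi (hj₀ j), hk j, ← hk j₀, T.role_eq_gap_iff hi le_rfl] at h
      exact lt_irrefl _ h
    exact T.not_block hf H hlev fun j => by rw [← T.role_of_eq (hlev j), hk j]
  · have hl := T.l_val
    have ho := T.o_val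
    have hqp := T.q_lt_p
    have hle := (f j₀).2.1
    rw [← h1] at hi hle h2 h3 h4 hj₀
    simp only [cutSet, Set.mem_ofPred_eq] at h4
    rcases (by omega : (f j).1.1 = N + 3 ∨ (f j).1.1 = N + 2 ∨ (f j).1.1 = N + 1 ∨
      (f j).1.1 ≤ N) with e | e | e | e
    · have c1 := T.color_single (a := f j) (by
        simp only [h2]
        simp [e, IsSingle, cutter, hl])
      rw [if_pos e] at h4
      have c2 := T.color_single (a := f j') (by
        rcases h4 with h4 | h4
        · simp [IsSingle, h4.1, h4.2]
        · simp [IsSingle, h4.1, h4.2])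
      rw [H j j', c2] at c1
      simp only [e, Nat.odd_iff] at c1 hN
      omega
    · have c1 := T.color_single (a := f j) (by
        simp only [h2]
        simp [e, IsSingle, cutter, hqp])
      rw [if_neg (by omega), if_pos e] at h4
      have c2 := T.color_single (a := f j') (by simp [IsSingle, h4.1, h4.2])
      rw [H j j', c2] at c1
      simp only [e, Nat.odd_iff] at c1
      omega
    · have c1 := T.color_single (a := f j) (by
        simp only [h2]
        simp [e, IsSingle, cutter])
      rw [if_neg (by omega), if_neg (by omega)] at h4
      have c2 := T.color_chain (a := f j') (by omega) h4.2
      rw [H j j', c2] at c1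
      simp only [e, Nat.odd_iff] at c1
      omega
    · rw [if_neg (by omega), if_neg (by omega)] at h4
      exact T.not_chain hf H (m := (f j').1.1) (by omega) (fun t => by have := hj₀ t; omega)
        ⟨j, by omega⟩ ⟨j', rfl, h4.2⟩

end Frame

end PermLogic

/-! ### Ehrenfeucht–Fraïssé games and quantifier rank -/

namespace PermLogic

open Function FirstOrder Language

section BackForth

variable {A B V W V' W' : Type*} [LT V] [LT W] [LT V'] [LT W']

/-- Two tuples of points of planar point sets have the same order type in both coordinates. -/
def Agree (X : A → V) (Y : A → W) (X' : B → V') (Y' : B → W') {m : ℕ} (a : Fin m → A)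
    (b : Fin m → B) : Prop :=
  ∀ i j, (X (a i) < X (a j) ↔ X' (b i) < X' (b j)) ∧ (Y (a i) < Y (a j) ↔ Y' (b i) < Y' (b j))

/-- The duplicator wins the Ehrenfeucht–Fraïssé game with `r` rounds from the given position. -/
def BackForth (X : A → V) (Y : A → W) (X' : B → V') (Y' : B → W') :
    ℕ → (m : ℕ) → (Fin m → A) → (Fin m → B) → Prop
  | 0, _, a, b => Agree X Y X' Y' a b
  | r + 1, m, a, b => Agree X Y X' Y' a b ∧
      (∀ x, ∃ y, BackForth X Y X' Y' r (m + 1) (Fin.snoc a x) (Fin.snoc b y)) ∧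
      ∀ y, ∃ x, BackForth X Y X' Y' r (m + 1) (Fin.snoc a x) (Fin.snoc b y)

theorem BackForth.agree {X : A → V} {Y : A → W} {X' : B → V'} {Y' : B → W'} {r m : ℕ}
    {a : Fin m → A} {b : Fin m → B} (h : BackForth X Y X' Y' r m a b) : Agree X Y X' Y' a b := by
  cases r with
  | zero => exact h
  | succ r => exact h.1

theorem BackForth.map {A₂ B₂ V₂ W₂ V₂' W₂' : Type*} [LT V₂] [LT W₂] [LT V₂'] [LT W₂']
    {X : A → V} {Y : A → W} {X' : B → V'} {Y' : B → W'}
    {X₂ : A₂ → V₂} {Y₂ : A₂ → W₂} {X₂' : B₂ → V₂'} {Y₂' : B₂ → W₂'} (e : A ≃ A₂) (e' : B ≃ B₂)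
    (H : ∀ {m : ℕ} (a : Fin m → A) (b : Fin m → B), Agree X Y X' Y' a b →
      Agree X₂ Y₂ X₂' Y₂' (e ∘ a) (e' ∘ b)) (r : ℕ) :
    ∀ {m : ℕ} (a : Fin m → A) (b : Fin m → B), BackForth X Y X' Y' r m a b →
      BackForth X₂ Y₂ X₂' Y₂' r m (e ∘ a) (e' ∘ b) := by
  induction r with
  | zero => exact H
  | succ r ih =>
    rintro m a b ⟨h1, h2, h3⟩
    refine ⟨H a b h1, fun x => ?_, fun y => ?_⟩
    · obtain ⟨y, hy⟩ := h2 (e.symm x)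
      refine ⟨e' y, ?_⟩
      have := ih _ _ hy
      rwa [Fin.comp_snoc, Fin.comp_snoc, e.apply_symm_apply] at this
    · obtain ⟨x, hx⟩ := h3 (e'.symm y)
      refine ⟨e x, ?_⟩
      have := ih _ _ hx
      rwa [Fin.comp_snoc, Fin.comp_snoc, e'.apply_symm_apply] at this

end BackForth

/-- The quantifier rank. -/
def quantifierRank : {m : ℕ} → twoOrders.BoundedFormula Empty m → ℕ
  | _, .falsum => 0
  | _, .equal _ _ => 0
  | _, .rel _ _ => 0
  | _, .imp φ ψ => max (quantifierRank φ) (quantifierRank ψ)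
  | _, .all φ => quantifierRank φ + 1

theorem exists_eq_var {m : ℕ} (t : twoOrders.Term (Empty ⊕ Fin m)) :
    ∃ i : Fin m, t = Term.var (Sum.inr i) := by
  rcases t with (x | i) | ⟨f, _⟩
  · exact x.elim
  · exact ⟨i, rfl⟩
  · exact Empty.elim f

/-- Equality is expressed through `<₁`, which is why `Agree` need not mention it. -/
theorem diagram_eq_iff {n : ℕ} {π : Equiv.Perm (Fin n)} (p q : diagram π) :
    p = q ↔ ¬ p.1.1 < q.1.1 ∧ ¬ q.1.1 < p.1.1 := by
  constructor
  · rintro rfl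
    exact ⟨lt_irrefl _, lt_irrefl _⟩
  · rintro ⟨h1, h2⟩
    have h3 : p.1.1 = q.1.1 := le_antisymm (not_lt.1 h2) (not_lt.1 h1)
    have hp : p.1.2 = π p.1.1 := p.2
    have hq : q.1.2 = π q.1.1 := q.2
    exact Subtype.ext (Prod.ext h3 (hp.trans ((congrArg π h3).trans hq.symm)))

theorem realize_iff_of_backForth {n n' : ℕ} (π : Equiv.Perm (Fin n)) (π' : Equiv.Perm (Fin n'))
    {m : ℕ} (φ : twoOrders.BoundedFormula Empty m) : ∀ (r : ℕ), quantifierRank φ ≤ r →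
    ∀ (a : Fin m → diagram π) (b : Fin m → diagram π'),
    BackForth (fun p : diagram π => p.1.1) (fun p => p.1.2) (fun p : diagram π' => p.1.1)
      (fun p => p.1.2) r m a b →
    (@BoundedFormula.Realize twoOrders (diagram π) (permStructure π) _ _ φ default a ↔
      @BoundedFormula.Realize twoOrders (diagram π') (permStructure π') _ _ φ default b) := by
  let _ := permStructure π
  let _ := permStructure π'
  induction φ with
  | falsum => intros; exact Iff.rfl
  | equal t₁ t₂ =>
    intro r _ a b h
    obtain ⟨i, rfl⟩ := exists_eq_var t₁
    obtain ⟨j, rfl⟩ := exists_eq_var t₂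
    change a i = a j ↔ b i = b j
    rw [diagram_eq_iff, diagram_eq_iff, (h.agree i j).1, (h.agree j i).1]
  | rel R ts =>
    intro r _ a b h
    cases R with
    | lt₁ =>
      obtain ⟨i, hi⟩ := exists_eq_var (ts 0)
      obtain ⟨j, hj⟩ := exists_eq_var (ts 1)
      change ((ts 0).realize (Sum.elim default a)).1.1 < ((ts 1).realize (Sum.elim default a)).1.1
        ↔ ((ts 0).realize (Sum.elim default b)).1.1 < ((ts 1).realize (Sum.elim default b)).1.1
      rw [hi, hj]
      exact (h.agree i j).1
    | lt₂ =>
      obtain ⟨i, hi⟩ := exists_eq_var (ts 0)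
      obtain ⟨j, hj⟩ := exists_eq_var (ts 1)
      change ((ts 0).realize (Sum.elim default a)).1.2 < ((ts 1).realize (Sum.elim default a)).1.2
        ↔ ((ts 0).realize (Sum.elim default b)).1.2 < ((ts 1).realize (Sum.elim default b)).1.2
      rw [hi, hj]
      exact (h.agree i j).2
  | imp φ ψ ih₁ ih₂ =>
    intro r hr a b h
    simp only [quantifierRank, max_le_iff] at hr
    exact imp_congr (ih₁ r hr.1 a b h) (ih₂ r hr.2 a b h)
  | all φ ih =>
    intro r hr a b h
    simp only [quantifierRank] at hr
    obtain ⟨s, rfl⟩ : ∃ s, r = s + 1 := ⟨r - 1, by omega⟩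
    obtain ⟨-, h2, h3⟩ := h
    constructor
    · intro H y
      obtain ⟨x, hx⟩ := h3 y
      exact (ih s (by omega) _ _ hx).1 (H x)
    · intro H x
      obtain ⟨y, hy⟩ := h2 x
      exact (ih s (by omega) _ _ hy).2 (H y)

/-! ### Truncated distances between levels -/

/-- The integers `x` and `x'` are equal up to truncation at `t`. -/
def Near (t x x' : ℤ) : Prop := x = x' ∨ (t ≤ x ∧ t ≤ x') ∨ (x ≤ -t ∧ x' ≤ -t)

/-- The differences in a set of pairs of integers agree up to truncation at `t`. -/
def Matched (t : ℤ) (S : Set (ℤ × ℤ)) : Prop :=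
  ∀ p ∈ S, ∀ q ∈ S, Near t (p.1 - q.1) (p.2 - q.2)

/-- One round halves the truncation. With `b` and `c` the neighbours of `x` in `S`, a distance of at
most `t` from one of them is copied exactly. Otherwise `b` and `c` are more than `2 * t` apart, and
the answer `b.2 + t` is at least `t` away from both images. -/
theorem Matched.exists_insert {t : ℤ} (ht : 1 ≤ t) {S : Set (ℤ × ℤ)} (hS : S.Finite)
    (h : Matched (2 * t) S) {lo hi : ℤ × ℤ} (hlo : lo ∈ S) (hhi : hi ∈ S) {x : ℤ}
    (h1 : lo.1 ≤ x) (h2 : x ≤ hi.1) :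
    ∃ x', lo.2 ≤ x' ∧ x' ≤ hi.2 ∧ Matched t (insert (x, x') S) := by
  obtain ⟨b, ⟨hb, hbx⟩, hbm⟩ := Set.exists_max_image {p ∈ S | p.1 ≤ x} Prod.fst
    (hS.subset fun p hp => hp.1) ⟨lo, hlo, h1⟩
  obtain ⟨c, ⟨hc, hcx⟩, hcm⟩ := Set.exists_min_image {p ∈ S | x ≤ p.1} Prod.fst
    (hS.subset fun p hp => hp.1) ⟨hi, hhi, h2⟩
  have hsep : ∀ d ∈ S, d.1 ≤ b.1 ∨ c.1 ≤ d.1 := fun d hd => by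
    rcases le_total d.1 x with h | h
    · exact Or.inl (hbm d ⟨hd, h⟩)
    · exact Or.inr (hcm d ⟨hd, h⟩)
  have hbc := h c hc b hb
  have key : ∃ x', ∀ d ∈ S, Near t (x - d.1) (x' - d.2) ∧ (d.1 ≤ x → d.2 ≤ x') ∧
      (x ≤ d.1 → x' ≤ d.2) := by
    by_cases k1 : x - b.1 ≤ t
    · refine ⟨b.2 + (x - b.1), fun d hd => ?_⟩
      have e1 := hsep d hd
      have e2 := h d hd b hb
      have e3 := h d hd c hc
      unfold Near at *
      omega
    · by_cases k2 : c.1 - x ≤ t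
      · refine ⟨c.2 - (c.1 - x), fun d hd => ?_⟩
        have e1 := hsep d hd
        have e2 := h d hd b hb
        have e3 := h d hd c hc
        unfold Near at *
        omega
      · refine ⟨b.2 + t, fun d hd => ?_⟩
        have e1 := hsep d hd
        have e2 := h d hd b hb
        have e3 := h d hd c hc
        unfold Near at *
        omega
  obtain ⟨x', hx'⟩ := key
  refine ⟨x', (hx' lo hlo).2.1 h1, (hx' hi hhi).2.2 h2, ?_⟩
  rintro p (rfl | hp) q (rfl | hq)
  · exact Or.inl (by simp)
  · exact (hx' q hq).1
  · have := (hx' p hp).1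
    unfold Near at *
    dsimp only at *
    omega
  · have := h p hp q hq
    unfold Near at *
    omega

theorem Matched.swap {t : ℤ} {S : Set (ℤ × ℤ)} (h : Matched t S) : Matched t (Prod.swap '' S) := by
  rintro _ ⟨p, hp, rfl⟩ _ ⟨q, hq, rfl⟩
  have := h p hp q hq
  unfold Near at *
  dsimp only [Prod.swap]
  omega

theorem Matched.mono {t : ℤ} {S S' : Set (ℤ × ℤ)} (h : Matched t S) (hS : S' ⊆ S) :
    Matched t S' := fun p hp q hq => h p (hS hp) q (hS hq)

end PermLogic

/-! ### The duplicator's strategy on two chains -/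

namespace PermLogic

open Function

namespace Frame

variable {n : ℕ} (T : Frame n) {N N' : ℕ}

/-- The levels `i` and `i'` of the chains of length `N` and `N'` are of the same type. -/
def SameType (N N' i i' : ℕ) : Prop :=
  (i = 0 ↔ i' = 0) ∧ (i = N + 3 ↔ i' = N' + 3) ∧ (i = N + 2 ↔ i' = N' + 2) ∧
    (i = N + 1 ↔ i' = N' + 1)

theorem sameType_of_near {i i' : ℕ} (h1 : Near 8 (i : ℤ) i')
    (h2 : Near 8 ((N + 3 : ℤ) - i) ((N' + 3 : ℤ) - i')) : SameType N N' i i' := by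
  unfold Near at *
  unfold SameType
  omega

theorem gap_congr {i i' : ℕ} (h : SameType N N' i i') : T.gap N i = T.gap N' i' := by
  simp only [gap, h.2.1, h.2.2.1]

theorem isPoint_congr {i i' : ℕ} (h : SameType N N' i i') (hi' : i' ≤ N' + 3)
    {k : Fin n × Fin n} (hp : T.IsPoint N (i, k)) : T.IsPoint N' (i', k) := by
  obtain ⟨h1, h2, h3⟩ := hp
  refine ⟨hi', ?_, ?_⟩
  · rw [T.gap_congr h, h.1] at h2
    exact h2
  · simp only [IsSingle, h.1, h.2.1, h.2.2.1, h.2.2.2] at h3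
    exact h3

theorem xMin_congr {i i' : ℕ} (h : SameType N N' i i') (k : Fin n) :
    xMin N i k = xMin N' i' k := by
  simp only [xMin, h.1, h.2.1, h.2.2.1]

theorem yMin_congr {i i' : ℕ} (h : SameType N N' i i') (k : Fin n) :
    T.yMin N i k = T.yMin N' i' k := by
  simp only [yMin, h.2.2.1]

/-- The major coordinates `u` and `u'` depend in the same way on the levels `i` and `i'`. -/
def SameMaj (i i' u u' : ℤ) : Prop :=
  u = 0 ∧ u' = 0 ∨ u = i ∧ u' = i' ∨ u = i - 1 ∧ u' = i' - 1 ∨ u = -i ∧ u' = -i'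

/-- `Near 1` says that the two differences have the same sign. The threshold 8 leaves room for the
shifts by one and for the sums produced by opposite signs. -/
theorem near_of_sameMaj {i i' j j' u u' v v' : ℤ} (h0 : 0 ≤ i) (h0' : 0 ≤ j) (h1 : Near 8 i i')
    (h2 : Near 8 j j') (h3 : Near 8 (i - j) (i' - j')) (hu : SameMaj i i' u u')
    (hv : SameMaj j j' v v') : Near 1 (u - v) (u' - v') := by
  unfold SameMaj at *
  unfold Near at *
  rcases hu with ⟨rfl, rfl⟩ | ⟨rfl, rfl⟩ | ⟨rfl, rfl⟩ | ⟨rfl, rfl⟩ <;>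
    rcases hv with ⟨rfl, rfl⟩ | ⟨rfl, rfl⟩ | ⟨rfl, rfl⟩ | ⟨rfl, rfl⟩ <;> omega

theorem sameMaj_xMaj {i i' : ℕ} (h : SameType N N' i i') (k : Fin n) :
    SameMaj i i' (T.xMaj N i k) (T.xMaj N' i' k) := by
  have h1 := h.2.1
  have h2 := h.2.2.1
  simp only [SameMaj, xMaj, h.1, h.2.1, h.2.2.1]
  split_ifs <;> omega

theorem sameMaj_yMaj {i i' : ℕ} (h : SameType N N' i i') (k : Fin n) :
    SameMaj i i' (T.yMaj N i k) (T.yMaj N' i' k) := by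
  have h2 := h.2.2.1
  simp only [SameMaj, yMaj, h.2.2.1, T.gap_congr h]
  split_ifs <;> omega

/-- The pairs of levels of corresponding points, and of the ends of the chains. -/
def levelPairs {m : ℕ} (a : Fin m → T.Point N) (b : Fin m → T.Point N') : Set (ℤ × ℤ) :=
  insert (0, 0) (insert ((N : ℤ) + 3, (N' : ℤ) + 3)
    (Set.range fun i => (((a i).1.1 : ℤ), ((b i).1.1 : ℤ))))

theorem zero_mem_levelPairs {m : ℕ} (a : Fin m → T.Point N) (b : Fin m → T.Point N') :
    (0, 0) ∈ T.levelPairs a b := Or.inl rfl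

theorem top_mem_levelPairs {m : ℕ} (a : Fin m → T.Point N) (b : Fin m → T.Point N') :
    ((N : ℤ) + 3, (N' : ℤ) + 3) ∈ T.levelPairs a b := Or.inr (Or.inl rfl)

theorem mem_levelPairs {m : ℕ} (a : Fin m → T.Point N) (b : Fin m → T.Point N') (i : Fin m) :
    (((a i).1.1 : ℤ), ((b i).1.1 : ℤ)) ∈ T.levelPairs a b := Or.inr (Or.inr ⟨i, rfl⟩)

theorem levelPairs_finite {m : ℕ} (a : Fin m → T.Point N) (b : Fin m → T.Point N') :
    (T.levelPairs a b).Finite :=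
  ((Set.finite_range _).insert _).insert _

theorem levelPairs_swap {m : ℕ} (a : Fin m → T.Point N) (b : Fin m → T.Point N') :
    Prod.swap '' T.levelPairs a b = T.levelPairs b a := by
  simp only [levelPairs, Set.image_insert_eq, Prod.swap, ← Set.range_comp]
  rfl

theorem levelPairs_snoc {m : ℕ} (a : Fin m → T.Point N) (b : Fin m → T.Point N')
    (x : T.Point N) (y : T.Point N') :
    T.levelPairs (Fin.snoc a x : Fin (m + 1) → T.Point N) (Fin.snoc b y) ⊆
      insert ((x.1.1 : ℤ), (y.1.1 : ℤ)) (T.levelPairs a b) := by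
  rintro p (rfl | rfl | ⟨i, rfl⟩)
  · exact Or.inr (T.zero_mem_levelPairs a b)
  · exact Or.inr (T.top_mem_levelPairs a b)
  · induction i using Fin.lastCases with
    | last => simp
    | cast i => simpa using Or.inr (T.mem_levelPairs a b i)

theorem agree_of_matched {m : ℕ} {a : Fin m → T.Point N} {b : Fin m → T.Point N'} {t : ℤ}
    (ht : 8 ≤ t) (h : Matched t (T.levelPairs a b)) (hab : ∀ i, (a i).1.2 = (b i).1.2) :
    Agree (T.X N) (T.Y N) (T.X N') (T.Y N') a b := by
  intro i j
  have weak : ∀ {x x' : ℤ}, Near t x x' → Near 8 x x' := fun h => by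
    unfold Near at *; omega
  have i0 := weak (h _ (T.mem_levelPairs a b i) _ (T.zero_mem_levelPairs a b))
  have i1 := weak (h _ (T.top_mem_levelPairs a b) _ (T.mem_levelPairs a b i))
  have j0 := weak (h _ (T.mem_levelPairs a b j) _ (T.zero_mem_levelPairs a b))
  have j1 := weak (h _ (T.top_mem_levelPairs a b) _ (T.mem_levelPairs a b j))
  simp only [sub_zero] at i0 j0
  have ij := weak (h _ (T.mem_levelPairs a b i) _ (T.mem_levelPairs a b j))
  have ti := sameType_of_near i0 i1
  have tj := sameType_of_near j0 j1
  rw [X_lt_iff, Y_lt_iff, X_lt_iff, Y_lt_iff, hab i, hab j, xMin_congr ti, xMin_congr tj,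
    T.yMin_congr ti, T.yMin_congr tj]
  have hx := near_of_sameMaj (by omega) (by omega) i0 j0 ij
    (T.sameMaj_xMaj ti (b i).1.2.1) (T.sameMaj_xMaj tj (b j).1.2.1)
  have hy := near_of_sameMaj (by omega) (by omega) i0 j0 ij
    (T.sameMaj_yMaj ti (b i).1.2.1) (T.sameMaj_yMaj tj (b j).1.2.1)
  unfold Near at hx hy
  constructor <;> omega

/-- The reply keeps the position and the place inside the block; only the level is chosen by the
game on integers. -/
theorem exists_snoc {m : ℕ} {a : Fin m → T.Point N} {b : Fin m → T.Point N'} {t : ℤ}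
    (ht : 8 ≤ t) (h : Matched (2 * t) (T.levelPairs a b)) (hab : ∀ i, (a i).1.2 = (b i).1.2)
    (x : T.Point N) :
    ∃ y : T.Point N', Matched t (T.levelPairs (Fin.snoc a x : Fin (m + 1) → T.Point N)
      (Fin.snoc b y)) ∧ ∀ i,
        ((Fin.snoc a x : Fin (m + 1) → T.Point N) i).1.2 =
          ((Fin.snoc b y : Fin (m + 1) → T.Point N') i).1.2 := by
  have hx := x.2.1
  obtain ⟨x', h1, h2, h3⟩ := h.exists_insert (by omega) (T.levelPairs_finite a b)
    (T.zero_mem_levelPairs a b) (T.top_mem_levelPairs a b) (x := x.1.1) (by simp)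
    (by simp only; omega)
  simp only at h1 h2
  lift x' to ℕ using h1
  have i0 := h3 _ (Or.inl rfl) _ (Or.inr (T.zero_mem_levelPairs a b))
  have i1 := h3 _ (Or.inr (T.top_mem_levelPairs a b)) _ (Or.inl rfl)
  have weak : ∀ {x x' : ℤ}, Near t x x' → Near 8 x x' := fun h => by
    unfold Near at *; omega
  simp only [sub_zero] at i0
  let y : T.Point N' := ⟨(x', x.1.2),
    T.isPoint_congr (sameType_of_near (weak i0) (weak i1)) (by omega) x.2⟩
  refine ⟨y, h3.mono (T.levelPairs_snoc a b x y), fun i => ?_⟩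
  induction i using Fin.lastCases with
  | last => simp [y]
  | cast i => simpa using hab i

theorem backForth_of_matched (r : ℕ) : ∀ {m : ℕ} (a : Fin m → T.Point N)
    (b : Fin m → T.Point N'), Matched (8 * 2 ^ r) (T.levelPairs a b) →
    (∀ i, (a i).1.2 = (b i).1.2) →
    BackForth (T.X N) (T.Y N) (T.X N') (T.Y N') r m a b := by
  induction r with
  | zero =>
    intro m a b h hab
    exact T.agree_of_matched (by norm_num) h hab
  | succ r ih =>
    intro m a b h hab
    have hp : (1 : ℤ) ≤ 2 ^ r := one_le_pow₀ (by norm_num)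
    have h' : Matched (2 * (8 * 2 ^ r)) (T.levelPairs a b) := by
      rw [show (2 : ℤ) * (8 * 2 ^ r) = 8 * 2 ^ (r + 1) by ring]
      exact h
    refine ⟨T.agree_of_matched (by rw [pow_succ]; omega) h hab, fun x => ?_, fun y => ?_⟩
    · obtain ⟨y, h1, h2⟩ := T.exists_snoc (t := 8 * 2 ^ r) (by omega) h' hab x
      exact ⟨y, ih _ _ h1 h2⟩
    · obtain ⟨x, h1, h2⟩ := T.exists_snoc (t := 8 * 2 ^ r) (by omega)
        (by rw [← T.levelPairs_swap]; exact h'.swap) (fun i => (hab i).symm) y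
      refine ⟨x, ih _ _ ?_ fun i => (h2 i).symm⟩
      rw [← T.levelPairs_swap]
      exact h1.swap

/-- At the start only the two ends are marked, and in both chains they are more than `8 * 2 ^ r`
apart. -/
theorem backForth_succ (r : ℕ) : BackForth (T.X (8 * 2 ^ r)) (T.Y (8 * 2 ^ r))
    (T.X (8 * 2 ^ r + 1)) (T.Y (8 * 2 ^ r + 1)) r 0 Fin.elim0 Fin.elim0 := by
  refine T.backForth_of_matched r _ _ ?_ fun i => i.elim0
  rintro p (rfl | rfl | ⟨i, -⟩)
  · rintro q (rfl | rfl | ⟨i, -⟩)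
    · exact Or.inl rfl
    · refine Or.inr (Or.inr ⟨?_, ?_⟩) <;> push_cast <;> omega
    · exact i.elim0
  · rintro q (rfl | rfl | ⟨i, -⟩)
    · refine Or.inr (Or.inl ⟨?_, ?_⟩) <;> push_cast <;> omega
    · exact Or.inl (by simp)
    · exact i.elim0
  · exact i.elim0

end Frame

end PermLogic

/-! ### Conclusion -/

namespace PermLogic

open Function FirstOrder

namespace Frame

instance {n : ℕ} (T : Frame n) (N : ℕ) : Finite (T.Point N) := by
  refine Finite.of_injective
    (fun a : T.Point N => ((⟨a.1.1, Nat.lt_succ_of_le a.2.1⟩ : Fin (N + 4)), a.1.2)) ?_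
  intro a b h
  simp only [Prod.mk.injEq, Fin.mk.injEq] at h
  exact Subtype.ext (Prod.ext h.1 h.2)

/-- The map `g` allows the vertical order to be reversed, so that a frame for the reflected pattern
also serves for `α`. -/
theorem not_isFODefinable {n : ℕ} (T : Frame n) (α : Equiv.Perm (Fin n)) {W : Type*}
    [LinearOrder W] (g : ℤ ×ₗ ℤ ×ₗ ℤ → W) (hg : Injective g)
    (hcopy : ∀ N (f : Fin n → T.Point N), IsCopy id α (T.X N) (g ∘ T.Y N) f ↔
      IsCopy (id : Fin n → Fin n) T.h (T.X N) (T.Y N) f)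
    (hagree : ∀ {N N' m : ℕ} (a : Fin m → T.Point N) (b : Fin m → T.Point N'),
      Agree (T.X N) (T.Y N) (T.X N') (T.Y N') a b →
        Agree (T.X N) (g ∘ T.Y N) (T.X N') (g ∘ T.Y N') a b) :
    ¬ IsFODefinable (merge (Av α) (Av α)) := by
  rintro ⟨φ, hφ⟩
  have hn := T.four_le
  let r := quantifierRank φ
  let N := 8 * 2 ^ r
  obtain ⟨π, e, he⟩ := exists_perm_of_injective (T.X N) (g ∘ T.Y N) T.X_injective
    (hg.comp T.Y_injective)
  obtain ⟨π', e', he'⟩ := exists_perm_of_injective (T.X (N + 1)) (g ∘ T.Y (N + 1)) T.X_injective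
    (hg.comp T.Y_injective)
  have hbf := BackForth.map (X₂ := fun p : diagram π => p.1.1)
    (Y₂ := fun p : diagram π => p.1.2) (X₂' := fun p : diagram π' => p.1.1)
    (Y₂' := fun p : diagram π' => p.1.2) e e' (fun a b hab i j => by
      have h1 := hagree a b hab i j
      have h2 := he (a i) (a j)
      have h3 := he' (b i) (b j)
      exact ⟨h2.1.trans (h1.1.trans h3.1.symm), h2.2.trans (h1.2.trans h3.2.symm)⟩) r _ _
    (T.backForth_succ r)
  have hiff := realize_iff_of_backForth π π' φ r le_rfl _ _ hbf
  rw [Subsingleton.elim (e ∘ Fin.elim0) default, Subsingleton.elim (e' ∘ Fin.elim0) default] at hiff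
  have h1 : (⟨_, π⟩ : Σ n : ℕ, Equiv.Perm (Fin n)) ∈ merge (Av α) (Av α) ↔
      (⟨_, π'⟩ : Σ n : ℕ, Equiv.Perm (Fin n)) ∈ merge (Av α) (Av α) :=
    (hφ _ π).symm.trans (Iff.trans hiff (hφ _ π'))
  rw [mem_merge_Av_iff (by omega) α π (T.X N) (g ∘ T.Y N) e he,
    mem_merge_Av_iff (by omega) α π' (T.X (N + 1)) (g ∘ T.Y (N + 1)) e' he'] at h1
  have hN : Even N := (by norm_num : Even 8).mul_right _
  obtain ⟨c, hc⟩ := h1.2 ⟨T.color, fun f hf => T.colorable hN.add_one ((hcopy _ f).1 hf)⟩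
  exact T.not_colorable hN c fun f hf => hc f ((hcopy _ f).2 hf)

end Frame

theorem IntervalFree.exists_frame {n : ℕ} (hn : 4 ≤ n) {h : Fin n → ℤ} (inj : Injective h)
    (free : IntervalFree (id : Fin n → Fin n) h)
    (h01 : h ⟨1, by omega⟩ < h ⟨0, by omega⟩) : ∃ T : Frame n, T.h = h := by
  have hasc : ∃ k m : Fin n, k < m ∧ h k < h m := by
    by_contra! hc
    have hanti : ∀ k m : Fin n, k < m → h m < h k := fun k m hkm =>
      lt_of_le_of_ne (hc k m hkm) (inj.ne hkm.ne')
    -- Without an ascent the pattern is decreasing, and its first two positions form an interval.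
    rcases free {k | k.1 < 2} (fun z hz s hs t ht => by
      rw [Set.mem_ofPred_eq] at hz hs ht
      have h1 := hanti s z (by rw [Fin.lt_def]; omega)
      have h2 := hanti t z (by rw [Fin.lt_def]; omega)
      simp only [id, Fin.lt_def]
      omega) with h1 | h1
    · have := @h1 ⟨0, by omega⟩ (by simp) ⟨1, by omega⟩ (by simp)
      simp at this
    · have : (⟨2, by omega⟩ : Fin n) ∈ {k : Fin n | k.1 < 2} := by rw [h1]; trivial
      simp at this
  obtain ⟨k, m, hkm⟩ := hasc
  -- In an ascent of least height no value lies strictly between the two: a point there would form a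
  -- lower ascent with `p` or with `q`.
  obtain ⟨⟨q, p⟩, ⟨h1, h2⟩, hmin⟩ := Set.exists_min_image
    {z : Fin n × Fin n | z.1 < z.2 ∧ h z.1 < h z.2} (fun z => h z.2 - h z.1)
    (Set.toFinite _) ⟨(k, m), hkm⟩
  dsimp only at h1 h2 hmin
  refine ⟨⟨h, inj, free, hn, ⟨0, by omega⟩, ⟨1, by omega⟩, rfl, rfl, h01, p, q, h1, h2, ?_⟩, rfl⟩
  intro j
  by_contra! hj
  rcases lt_or_ge j p with hjp | hjp
  · have := hmin (j, p) ⟨hjp, hj.2⟩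
    dsimp only at this
    omega
  · have := hmin (q, j) ⟨lt_of_lt_of_le h1 hjp, hj.1⟩
    dsimp only at this
    omega

end PermLogic

theorem mainTheorem4 (n : ℕ) (hn : 4 ≤ n) (α : Equiv.Perm (Fin n))
    (hα : PermLogic.IsSimple α) :
    ¬ PermLogic.IsFODefinable (PermLogic.merge (PermLogic.Av α) (PermLogic.Av α)) := by
  have free := hα.intervalFree
  have hinj : Function.Injective fun k => ((α k).1 : ℤ) := fun k m h => by
    simp only [Nat.cast_inj] at h
    exact α.injective (Fin.ext h)
  have hlt : ∀ k m, ((α k).1 : ℤ) < (α m).1 ↔ α k < α m := fun k m => by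
    rw [Nat.cast_lt, Fin.lt_def]
  rcases lt_or_gt_of_ne (α.injective.ne (a₁ := ⟨0, by omega⟩) (a₂ := ⟨1, by omega⟩)
    (by simp)) with h | h
  -- A frame must start with a descent; if `α` starts with an ascent, its values are negated and the
  -- vertical order is dualised.
  · obtain ⟨T, hT⟩ := PermLogic.IntervalFree.exists_frame hn (h := fun k => -((α k).1 : ℤ))
      (neg_injective.comp hinj) (fun S hS => free S fun z hz s hs t ht => by
        have h1 := hS z hz s hs t ht
        have h2 := hS s
        simp only [neg_lt_neg_iff, hlt] at h1
        have hzs : α z ≠ α s := α.injective.ne fun e => hz (e ▸ hs)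
        have hzt : α z ≠ α t := α.injective.ne fun e => hz (e ▸ ht)
        refine ⟨h1.1, ?_⟩
        rw [← not_iff_not, not_lt, not_lt, le_iff_lt_or_eq, le_iff_lt_or_eq, h1.2]
        simp [hzs.symm, hzt.symm]) (neg_lt_neg ((hlt _ _).2 h))
    refine T.not_isFODefinable α OrderDual.toDual OrderDual.toDual.injective ?_ ?_
    · intro N f
      have key : ∀ i j, α i < α j ↔ T.h j < T.h i := fun i j => by
        rw [hT, neg_lt_neg_iff, hlt]
      constructor
      · exact fun hf i j => ⟨(hf i j).1, (hf j i).2.trans (key j i)⟩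
      · exact fun hf i j => ⟨(hf i j).1, (hf j i).2.trans (key i j).symm⟩
    · exact fun a b hab i j => ⟨(hab i j).1, (hab j i).2⟩
  · obtain ⟨T, hT⟩ := PermLogic.IntervalFree.exists_frame hn (h := fun k => ((α k).1 : ℤ))
      hinj (fun S hS => free S fun z hz s hs t ht => by
        have h1 := hS z hz s hs t ht
        simp only [hlt] at h1
        exact h1) ((hlt _ _).2 h)
    refine T.not_isFODefinable α id Function.injective_id ?_ fun a b hab => hab
    intro N f
    have key : ∀ i j, α i < α j ↔ T.h i < T.h j := fun i j => by
      rw [hT, hlt]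
    constructor
    · exact fun hf i j => ⟨(hf i j).1, (hf i j).2.trans (key i j)⟩
    · exact fun hf i j => ⟨(hf i j).1, (hf i j).2.trans (key i j).symm⟩
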